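/- For $q,\nu\ge 0$ let $\mathbb R^{q+\nu}_\nu$ be $\mathbb R^{q+\nu}$ with the scalar product $\langle x,y\rangle=\sum_{i\le q}x_iy_i-\sum_{i>q}x_iy_i$. For $r>0$ let $H^{n+p}_p(r)=\{x\in\mathbb R^{n+p+1}_{p+1}:\langle x,x\rangle=-r^2\}$, and let $H^n(r)$ be the component of $H^n_0(r)$ through $(0,\dots,0,r)$, i.e. the hyperbolic space of radius $r$. The space $H^{n+1}_1(1)\subset\mathbb R^{n+2}_2$ is anti-de Sitter space. All submanifolds carry the metric induced by the scalar product. A space-like hypersurface $M$ of $N=H^{n+1}_1(1)$ is a smooth embedded submanifold of codimension one whose induced metric is positive definite. For the inclusion $\phi:M\to N$ let $B=\nabla d\phi$ be the second fundamental form, $\tau(\phi)=\operatorname{trace}B$ the tension field, $H=\tau(\phi)/\dim M$ the mean curvature vector field ($H=0$ if $\dim M=0$), $|B|^2$ and $|H|^2$ the length squares with respect to the (indefinite) metric of $N$, and $$\tau_2(\phi)=-\Delta^\phi\tau(\phi)-\operatorname{trace}R^N(d\phi,\tau(\phi))\,d\phi,\qquad \Delta^\phi=-\operatorname{trace}\nabla^2,\quad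 R(X,Y)=[\nabla_X,\nabla_Y]-\nabla_{[X,Y]}.$$ $M$ is proper biharmonic if $\tau_2(\phi)=0$ identically while $\tau(\phi)$ is not identically $0$. **(1) Hyperbolic space.** Let $n\ge 1$. For $|s|<1$, the part of $H^{n+1}_1(1)\cap\{x_{n+2}=s\}$ with $x_{n+1}>0$ is $H^n(\sqrt{1-s^2})\times\{s\}$. It is a space-like hypersurface of $H^{n+1}_1(1)$. At each of its points there is a time-like unit normal $\eta$ ($\langle\eta,\eta\rangle=-1$) with $B(X,Y)=\frac{s}{\sqrt{1-s^2}}\langle X,Y\rangle\,\eta$; moreover $|B|^2=n\frac{s^2}{s^2-1}$ and $|H|^2$ is constant. It is proper biharmonic if and only if $s^2=\frac12$. In particular $H^n(\frac1{\sqrt2})\subset H^{n+1}_1(1)$ (the case $s=\frac1{\sqrt2}$) is a proper biharmonic space-like hypersurface. **(2) Clifford torus.** Let $m,n\ge 0$ be integers and $r,s>0$ with $r^2+s^2=1$. Identify $\mathbb R^{m+n+2}_2$ with the orthogonal sum $\mathbb R^{m+1}_1\oplus\mathbb R^{n+1}_1$. Then $H^m(r)\times H^n(s)=\{(u,v):u\in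 H^m(r),\,v\in H^n(s)\}$ is a space-like hypersurface of $H^{m+n+1}_1(1)$. At each of its points there is a time-like unit normal $\eta$ such that, for tangent vectors $X=(X_1,X_2)$ and $Y=(Y_1,Y_2)$, $$B(X,Y)=\Big(\frac sr\langle X_1,Y_1\rangle-\frac rs\langle X_2,Y_2\rangle\Big)\eta ;$$ moreover $|B|^2=-\big(\frac{s^2}{r^2}m+\frac{r^2}{s^2}n\big)$ and $|H|^2$ is constant. It is proper biharmonic if and only if $m\ne n$ and $r=s$. In particular, for $m\neq n$, $H^m(\frac1{\sqrt2})\times H^n(\frac1{\sqrt2})\subset H^{m+n+1}_1(1)$ is a proper biharmonic space-like hypersurface. -/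

import Mathlib

open scoped ContDiff

noncomputable section

namespace BiharmonicADS

/-! ## Pseudo-Euclidean space and hyperquadrics -/

/-- The vector space `ℝ^{q+ν}_ν`: `q` space-like coordinates (`Sum.inl`), followed by
`ν` time-like ones (`Sum.inr`). -/
abbrev PE (q ν : ℕ) : Type := Fin q ⊕ Fin ν → ℝ

/-- The scalar product `x₁y₁ + ⋯ + x_q y_q - x_{q+1}y_{q+1} - ⋯ - x_{q+ν}y_{q+ν}`. -/
def pip {q ν : ℕ} (x y : PE q ν) : ℝ :=
  ∑ i : Fin q, x (Sum.inl i) * y (Sum.inl i) - ∑ j : Fin ν, x (Sum.inr j) * y (Sum.inr j)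

/-- The pseudohyperbolic space `H^{n+p}_p(r) = {x ∈ ℝ^{n+p+1}_{p+1} : ⟨x,x⟩ = -r²}`. -/
def pseudoHyperbolic (n p : ℕ) (r : ℝ) : Set (PE n (p + 1)) :=
  {x | pip x x = -r ^ 2}

/-- Anti-de Sitter space `H^{n+1}_1(1) ⊂ ℝ^{n+2}_2`. -/
def antiDeSitter (n : ℕ) : Set (PE n 2) := pseudoHyperbolic n 1 1

/-- The hyperbolic space `H^n(r)`: the component of `H^n_0(r)` through `(0, …, 0, r)`, `r > 0`,
that is the sheet on which the time-like coordinate is positive. -/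
def hyperbolic (n : ℕ) (r : ℝ) : Set (PE n 1) :=
  {x | x ∈ pseudoHyperbolic n 0 r ∧ 0 < x (Sum.inr 0)}

/-- The point `(z, s) ∈ ℝ^{n+2}_2` for `z ∈ ℝ^{n+1}_1`: the last coordinate `x_{n+2}` is `s`. -/
def slicePoint {n : ℕ} (z : PE n 1) (s : ℝ) : PE n 2 :=
  Sum.elim (fun i => z (Sum.inl i)) ![z (Sum.inr 0), s]

/-- The copy `H^n(r) × {s}` of `H^n(r)` in the affine hyperplane `x_{n+2} = s` of `ℝ^{n+2}_2`. -/
def hyperbolicSlice (n : ℕ) (r s : ℝ) : Set (PE n 2) :=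
  (fun z => slicePoint z s) '' hyperbolic n r

/-- The point `x = (u, v) ∈ ℝ^{m+n+2}_2` for `u ∈ ℝ^{m+1}_1` and `v ∈ ℝ^{n+1}_1`, with the
space-like coordinates listed first. -/
def pairPoint {m n : ℕ} (u : PE m 1) (v : PE n 1) : PE (m + n) 2 :=
  Sum.elim (Fin.append (fun i => u (Sum.inl i)) (fun j => v (Sum.inl j)))
    ![u (Sum.inr 0), v (Sum.inr 0)]

/-- The component in `ℝ^{m+1}_1` of a vector of `ℝ^{m+n+2}_2 = ℝ^{m+1}_1 ⊕ ℝ^{n+1}_1`. -/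
def fstPart {m n : ℕ} (x : PE (m + n) 2) : PE m 1 :=
  Sum.elim (fun i => x (Sum.inl (Fin.castAdd n i))) (fun _ => x (Sum.inr 0))

/-- The component in `ℝ^{n+1}_1` of a vector of `ℝ^{m+n+2}_2 = ℝ^{m+1}_1 ⊕ ℝ^{n+1}_1`. -/
def sndPart {m n : ℕ} (x : PE (m + n) 2) : PE n 1 :=
  Sum.elim (fun j => x (Sum.inl (Fin.natAdd m j))) (fun _ => x (Sum.inr 1))

/-- The product `H^m(r) × H^n(s)` as a subset of `ℝ^{m+n+2}_2`. -/
def cliffordTorus (m n : ℕ) (r s : ℝ) : Set (PE (m + n) 2) :=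
  {x | ∃ u ∈ hyperbolic m r, ∃ v ∈ hyperbolic n s, x = pairPoint u v}

/-- `(u, v) ↦ pairPoint u v` is a linear isometry from the orthogonal sum, so the metric induced on
`cliffordTorus` is the product metric. -/
theorem pip_pairPoint {m n : ℕ} (u u' : PE m 1) (v v' : PE n 1) :
    pip (pairPoint u v) (pairPoint u' v') = pip u u' + pip v v' := by
  simp only [pip, pairPoint, Sum.elim_inl, Sum.elim_inr, Fin.sum_univ_add, Fin.append_left,
    Fin.append_right, Fin.sum_univ_two, Fin.sum_univ_one, Matrix.cons_val_zero,
    Matrix.cons_val_one]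
  ring

theorem fstPart_pairPoint {m n : ℕ} (u : PE m 1) (v : PE n 1) :
    fstPart (pairPoint u v) = u := by
  funext i
  rcases i with i | i
  · simp [fstPart, pairPoint]
  · simp [fstPart, pairPoint, Subsingleton.elim i 0]

theorem sndPart_pairPoint {m n : ℕ} (u : PE m 1) (v : PE n 1) :
    sndPart (pairPoint u v) = v := by
  funext i
  rcases i with i | i
  · simp [sndPart, pairPoint]
  · simp [sndPart, pairPoint, Subsingleton.elim i 0]

/-! ## Pseudo-Riemannian geometry in local coordinates -/

/-- The coordinate space `ℝ^k` in which charts take their values. -/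
abbrev Co (k : ℕ) : Type := Fin k → ℝ

/-- A field of `k × k` matrices `(g_{ij})` on `ℝ^k`: a metric in coordinates. -/
abbrev MetricField (k : ℕ) : Type := Co k → Matrix (Fin k) (Fin k) ℝ

/-- The partial derivative `∂_i f`. -/
def pd {k : ℕ} {F : Type*} [NormedAddCommGroup F] [NormedSpace ℝ F] (i : Fin k)
    (f : Co k → F) (x : Co k) : F :=
  fderiv ℝ f x (Pi.single i 1)

/-- The scalar product of two tangent vectors, `g_{ij} u^i v^j`. -/
def metricInner {k : ℕ} (g : MetricField k) (x : Co k) (u v : Co k) : ℝ :=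
  ∑ i, ∑ j, g x i j * u i * v j

/-- The Christoffel symbol `Γ^c_{ab} = ½ g^{cd} (∂_a g_{bd} + ∂_b g_{ad} - ∂_d g_{ab})`
of the Levi-Civita connection. -/
def christoffel {k : ℕ} (g : MetricField k) (x : Co k) (c a b : Fin k) : ℝ :=
  (1 / 2) * ∑ d, (g x)⁻¹ c d *
    (pd a (fun y => g y b d) x + pd b (fun y => g y a d) x - pd d (fun y => g y a b) x)

/-- The component `R^d_{cab}` of the curvature tensor, `R(∂_a, ∂_b)∂_c = R^d_{cab} ∂_d`,
where `R(X,Y) = [∇_X, ∇_Y] - ∇_{[X,Y]}`. -/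
def riemann {k : ℕ} (g : MetricField k) (x : Co k) (d c a b : Fin k) : ℝ :=
  pd a (fun y => christoffel g y d b c) x - pd b (fun y => christoffel g y d a c) x
    + ∑ e, (christoffel g x d a e * christoffel g x e b c
      - christoffel g x d b e * christoffel g x e a c)

/-- The curvature `R(u, v)w`. -/
def curvature {k : ℕ} (g : MetricField k) (x : Co k) (u v w : Co k) : Co k :=
  fun d => ∑ a, ∑ b, ∑ c, riemann g x d c a b * u a * v b * w c

section Maps

variable {k d : ℕ}

/-- The connection of the bundle `φ⁻¹TN`: for a vector field `V` along `φ`,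
`(∇_i V)^c = ∂_i V^c + Γ^c_{ab}(φ) ∂_i φ^a V^b`. -/
def covAlong (h : MetricField d) (φ V : Co k → Co d) (i : Fin k) (x : Co k) : Co d :=
  fun c => pd i V x c + ∑ a, ∑ b, christoffel h (φ x) c a b * pd i φ x a * V x b

/-- The second fundamental form `(∇dφ)(∂_i, ∂_j) = ∇_i(∂_j φ) - Γ^l_{ij} ∂_l φ` of a map
`φ : (ℝ^k, g) → (ℝ^d, h)`. -/
def secondFundForm (g : MetricField k) (h : MetricField d) (φ : Co k → Co d) (x : Co k)
    (i j : Fin k) : Co d :=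
  covAlong h φ (pd j φ) i x - ∑ l, christoffel g x l i j • pd l φ x

/-- The tension field `τ(φ) = trace ∇dφ`. -/
def tension (g : MetricField k) (h : MetricField d) (φ : Co k → Co d) (x : Co k) : Co d :=
  ∑ i, ∑ j, (g x)⁻¹ i j • secondFundForm g h φ x i j

/-- `trace ∇²V = g^{ij} (∇_i ∇_j V - Γ^l_{ij} ∇_l V)` for a vector field `V` along `φ`. -/
def traceHessAlong (g : MetricField k) (h : MetricField d) (φ V : Co k → Co d) (x : Co k) :
    Co d :=
  ∑ i, ∑ j, (g x)⁻¹ i j •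
    (covAlong h φ (covAlong h φ V j) i x - ∑ l, christoffel g x l i j • covAlong h φ V l x)

/-- The second tension field `τ₂(φ) = -Δ^φ τ(φ) - trace R^N(dφ, τ(φ))dφ`, where
`Δ^φ = -trace ∇²`. -/
def bitension (g : MetricField k) (h : MetricField d) (φ : Co k → Co d) (x : Co k) : Co d :=
  traceHessAlong g h φ (tension g h φ) x
    - ∑ i, ∑ j, (g x)⁻¹ i j •
      curvature h (φ x) (pd i φ x) (tension g h φ x) (pd j φ x)

end Maps

/-! ## Submanifolds of pseudo-Euclidean space -/

section Submanifolds

variable {q ν : ℕ}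

/-- The matrix `⟨∂_i X, ∂_j X⟩` of the metric induced by a parametrization `X`. -/
def inducedMetric {k : ℕ} (X : Co k → PE q ν) : MetricField k :=
  fun x => Matrix.of fun i j => pip (pd i X x) (pd j X x)

/-- `X` restricted to the open set `U ⊆ ℝ^k` is a smooth local parametrization of `S`: a smooth
immersion that is a homeomorphism onto a relatively open subset of `S`. -/
structure IsLocalParam {k : ℕ} (S : Set (PE q ν)) (U : Set (Co k)) (X : Co k → PE q ν) :
    Prop where
  isOpen : IsOpen U
  smooth : ContDiffOn ℝ ∞ X U
  immersion : ∀ x ∈ U, Function.Injective (fderiv ℝ X x)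
  image_eq : ∃ W : Set (PE q ν), IsOpen W ∧ X '' U = S ∩ W
  inverse : ∃ ρ : PE q ν → Co k, ContinuousOn ρ (X '' U) ∧ ∀ x ∈ U, ρ (X x) = x

/-- `S` is a smooth `k`-dimensional (embedded) submanifold. -/
def IsSubmanifold (k : ℕ) (S : Set (PE q ν)) : Prop :=
  ∀ p ∈ S, ∃ (U : Set (Co k)) (X : Co k → PE q ν), IsLocalParam S U X ∧ p ∈ X '' U

/-- `M` is a space-like hypersurface, of dimension `k`, of the pseudo-Riemannian manifold `N`
of dimension `k + 1`; both carry the metric induced by the surrounding pseudo-Euclidean space. -/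
structure IsSpacelikeHypersurface (k : ℕ) (M N : Set (PE q ν)) : Prop where
  subset : M ⊆ N
  submanifold : IsSubmanifold k M
  ambient : IsSubmanifold (k + 1) N
  nondegenerate : ∀ (V : Set (Co (k + 1))) (Y : Co (k + 1) → PE q ν), IsLocalParam N V Y →
    ∀ y ∈ V, (inducedMetric Y y).det ≠ 0
  spacelike : ∀ (U : Set (Co k)) (X : Co k → PE q ν), IsLocalParam M U X →
    ∀ x ∈ U, (inducedMetric X x).PosDef

/-- A representation `φ` of the inclusion `M → N` in local coordinates: `X` parametrizes a part of
`M` (of dimension `k`), `Y` a part of `N` (of dimension `d`), and `X = Y ∘ φ`. -/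
structure LocalRep (k d : ℕ) (M N : Set (PE q ν)) where
  U : Set (Co k)
  X : Co k → PE q ν
  V : Set (Co d)
  Y : Co d → PE q ν
  φ : Co k → Co d
  paramM : IsLocalParam M U X
  paramN : IsLocalParam N V Y
  smooth : ContDiffOn ℝ ∞ φ U
  mapsTo : Set.MapsTo φ U V
  comp_eq : ∀ x ∈ U, X x = Y (φ x)

namespace LocalRep

variable {k d : ℕ} {M N : Set (PE q ν)} (R : LocalRep k d M N)

/-- The metric of `M` in the coordinates. -/
def g : MetricField k := inducedMetric R.X

/-- The metric of `N` in the coordinates. -/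
def h : MetricField d := inducedMetric R.Y

/-- The second fundamental form `B(∂_i, ∂_j)` of `M` in `N`. -/
def B (x : Co k) (i j : Fin k) : Co d := secondFundForm R.g R.h R.φ x i j

/-- The length square `|B|² = g^{ia} g^{jb} ⟨B_{ij}, B_{ab}⟩`. -/
def normSqB (x : Co k) : ℝ :=
  ∑ i, ∑ j, ∑ a, ∑ b, (R.g x)⁻¹ i a * (R.g x)⁻¹ j b *
    metricInner R.h (R.φ x) (R.B x i j) (R.B x a b)

/-- The mean curvature vector field `H = (1/k) trace B`. -/
def meanCurvature (x : Co k) : Co d := (1 / (k : ℝ)) • tension R.g R.h R.φ x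

/-- `η` is a unit time-like vector tangent to `N` and normal to `M` at the point with
coordinates `x`. -/
def IsUnitNormal (x : Co k) (η : Co d) : Prop :=
  metricInner R.h (R.φ x) η η = -1 ∧ ∀ i, metricInner R.h (R.φ x) η (pd i R.φ x) = 0

end LocalRep

/-- The length square `|H|²` of the mean curvature vector field of `M` in `N` is constant. -/
def HasConstantMeanCurvature (k d : ℕ) (M N : Set (PE q ν)) : Prop :=
  ∃ c : ℝ, ∀ R : LocalRep k d M N, ∀ x ∈ R.U,
    metricInner R.h (R.φ x) (R.meanCurvature x) (R.meanCurvature x) = c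

/-- The inclusion of `M` (dimension `k`) in `N` (dimension `d`) is harmonic: its tension field
vanishes. For a space-like hypersurface this says that `M` is maximal. -/
def IsHarmonic (k d : ℕ) (M N : Set (PE q ν)) : Prop :=
  ∀ R : LocalRep k d M N, ∀ x ∈ R.U, tension R.g R.h R.φ x = 0

/-- The inclusion of `M` in `N` is biharmonic: its second tension field vanishes. -/
def IsBiharmonic (k d : ℕ) (M N : Set (PE q ν)) : Prop :=
  ∀ R : LocalRep k d M N, ∀ x ∈ R.U, bitension R.g R.h R.φ x = 0

/-- Proper biharmonic: biharmonic and not harmonic. -/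
def IsProperBiharmonic (k d : ℕ) (M N : Set (PE q ν)) : Prop :=
  IsBiharmonic k d M N ∧ ¬ IsHarmonic k d M N

end Submanifolds

end BiharmonicADS

end

/-!
The metrics of the submanifold `M` and of anti-de Sitter space `N` are induced from a flat space, so
everything is computed there. A vector field `V` along the inclusion `φ` is identified with its
image `dY(V)`, where `Y` is the chart of `N`. Since `N = {⟨y, y⟩ = -1}`, the Gauss formula
`IsQuadricChart.pd_pd_eq` holds: the tangential part of the flat second derivative is given by the
Christoffel symbols, and the normal part is `⟨∂_a Y, ∂_b Y⟩ Y`. It yields two facts. By comparing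
third derivatives, `N` has constant curvature `-1` (`IsQuadricChart.curvature_eq`); and the
connection along `φ` is the flat derivative corrected by a multiple of the position vector
(`IsQuadricChart.fderiv_covAlong`).

In both families the unit normal of `M` at `p` is a diagonal affine function `η = t * p + c` of the
position: for `H^n(r) × {s}` it is `((s/r) u, -r)` at `(u, s)`, for `H^m(r) × H^n(s)` it is
`((s/r) u, -(r/s) v)` at `(u, v)`. Hence the shape operator is multiplication by `t`, and
`B(X, Y) = ⟨t X, Y⟩ η`. With `f` and `a` the traces of the shape operator and of its square, which
are obtained from the trace of `t` on the ambient space by splitting off the directions `p` and `η`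
(`HasDiagonalNormal.sum_eq_trace_frame`), one gets `τ(φ) = f η`, `|B|² = -a`, and, since `f` is
constant and `trace ∇²η = a η`, `τ₂(φ) = f (a - k) η` with `k = dim M`
(`HasDiagonalNormal.fderiv_bitension`). So `M` is proper biharmonic exactly when `f ≠ 0` and
`a = k`, which is elementary algebra in each family.

That the sets are space-like hypersurfaces is seen from graph parametrizations: `M` is a global
graph over the space-like coordinates, `N` is locally a graph over all coordinates but one time-like
one. The induced metric of `M` is definite because `p` and `η` already exhaust the two negative
directions of the ambient space (`pip_self_pos_of_orthogonal`).
-/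

namespace BiharmonicADS

open Filter Topology

/-! ### The scalar product -/

section ScalarProduct

variable {q ν : ℕ}

/-- The scalar product as a continuous bilinear map. -/
noncomputable def pipL (q ν : ℕ) : PE q ν →L[ℝ] PE q ν →L[ℝ] ℝ :=
  LinearMap.toContinuousBilinearMap <| LinearMap.mk₂ ℝ pip
    (fun x y z => by simp only [pip, Pi.add_apply, add_mul, Finset.sum_add_distrib]; ring)
    (fun c x y => by
      simp only [pip, Pi.smul_apply, smul_eq_mul, mul_assoc, ← Finset.mul_sum, mul_sub])
    (fun x y z => by simp only [pip, Pi.add_apply, mul_add, Finset.sum_add_distrib]; ring)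
    (fun c x y => by
      simp only [pip, Pi.smul_apply, smul_eq_mul, mul_left_comm _ c, ← Finset.mul_sum, mul_sub])

theorem pipL_apply (x y : PE q ν) : pipL q ν x y = pip x y := rfl

theorem pip_comm (x y : PE q ν) : pip x y = pip y x := by
  simp only [pip, mul_comm]

theorem pip_add_left (x y z : PE q ν) : pip (x + y) z = pip x z + pip y z := by
  simp only [← pipL_apply, map_add, add_apply]

theorem pip_add_right (x y z : PE q ν) : pip x (y + z) = pip x y + pip x z := by
  simp only [← pipL_apply, map_add]

theorem pip_sub_left (x y z : PE q ν) : pip (x - y) z = pip x z - pip y z := by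
  simp only [← pipL_apply, map_sub, sub_apply]

theorem pip_smul_left (c : ℝ) (x y : PE q ν) : pip (c • x) y = c * pip x y := by
  simp only [← pipL_apply, map_smul, smul_apply, smul_eq_mul]

theorem pip_smul_right (c : ℝ) (x y : PE q ν) : pip x (c • y) = c * pip x y := by
  simp only [← pipL_apply, map_smul, smul_eq_mul]

theorem pip_zero_left (y : PE q ν) : pip 0 y = 0 := by
  simp only [← pipL_apply, map_zero, zero_apply]

theorem pip_sum_left {ι : Type*} (s : Finset ι) (f : ι → PE q ν) (y : PE q ν) :
    pip (∑ i ∈ s, f i) y = ∑ i ∈ s, pip (f i) y := by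
  simp only [← pipL_apply, map_sum, sum_apply]

theorem pip_sum_right {ι : Type*} (s : Finset ι) (f : ι → PE q ν) (y : PE q ν) :
    pip y (∑ i ∈ s, f i) = ∑ i ∈ s, pip y (f i) := by
  simp only [← pipL_apply, map_sum]

/-- Diagonal endomorphisms are self-adjoint. -/
theorem pip_mul_left (t x y : PE q ν) : pip (t * x) y = pip x (t * y) := by
  simp only [pip, Pi.mul_apply]
  congr 1 <;> exact Finset.sum_congr rfl fun i _ => by ring

/-- The sign of a coordinate in the scalar product. -/
def sgn : Fin q ⊕ Fin ν → ℝ := Sum.elim (fun _ => 1) (fun _ => -1)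

theorem sgn_mul_self (i : Fin q ⊕ Fin ν) : sgn i * sgn i = 1 := by
  rcases i with i | i <;> simp [sgn]

theorem pip_single (i : Fin q ⊕ Fin ν) (w : PE q ν) : pip w (Pi.single i 1) = sgn i * w i := by
  rcases i with i | i <;> simp [pip, sgn, Pi.single_apply]

theorem pip_eq_sum (x y : PE q ν) : pip x y = ∑ i, sgn i * (x i * y i) := by
  simp [pip, sgn, Fintype.sum_sum_type, sub_eq_add_neg]

theorem eq_zero_of_forall_pip {w : PE q ν} (h : ∀ y, pip w y = 0) : w = 0 := by
  funext i
  have := pip_single i w ▸ h _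
  have h2 := sgn_mul_self i
  have : sgn i ≠ 0 := fun h0 => by simp [h0] at h2
  simp_all

theorem eq_zero_of_orthogonal {N : ℕ} (hN : N = q + ν) {b : Fin N → PE q ν}
    (hb : LinearIndependent ℝ b) {w : PE q ν} (hw : ∀ i, pip w (b i) = 0) : w = 0 := by
  have hs : Submodule.span ℝ (Set.range b) = ⊤ :=
    hb.span_eq_top_of_card_eq_finrank' (by simp [hN])
  refine eq_zero_of_forall_pip fun y => ?_
  have hle : Submodule.span ℝ (Set.range b) ≤ LinearMap.ker (pipL q ν w).toLinearMap := by
    rw [Submodule.span_le]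
    rintro _ ⟨i, rfl⟩
    exact hw i
  exact hle (hs ▸ Submodule.mem_top : y ∈ Submodule.span ℝ (Set.range b))

/-- Adjoining a non-isotropic vector that is orthogonal to a linearly independent family. -/
theorem linearIndependent_cons_of_orthogonal {N : ℕ} {b : Fin N → PE q ν} {u : PE q ν}
    (hb : LinearIndependent ℝ b) (hu : pip u u ≠ 0) (hub : ∀ i, pip u (b i) = 0) :
    LinearIndependent ℝ (Fin.cons u b : Fin (N + 1) → PE q ν) := by
  refine linearIndependent_finCons.2 ⟨hb, fun hmem => hu ?_⟩
  have hle : Submodule.span ℝ (Set.range b) ≤ LinearMap.ker (pipL q ν u).toLinearMap := by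
    rw [Submodule.span_le]
    rintro _ ⟨i, rfl⟩
    exact hub i
  exact hle hmem

end ScalarProduct

/-! ### Partial derivatives -/

section PartialDerivatives

variable {k d q ν : ℕ} {F G : Type*} [NormedAddCommGroup F] [NormedSpace ℝ F]
  [NormedAddCommGroup G] [NormedSpace ℝ G]

theorem fderiv_eq_sum_pd (f : Co k → F) (x v : Co k) :
    fderiv ℝ f x v = ∑ i, v i • pd i f x := by
  conv_lhs => rw [pi_eq_sum_univ' v]
  simp only [map_sum, map_smul, pd]

theorem pd_congr {f g : Co k → F} {x : Co k} (h : f =ᶠ[𝓝 x] g) (i : Fin k) :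
    pd i f x = pd i g x := by
  rw [pd, pd, h.fderiv_eq]

theorem pd_congr_of_isOpen {f g : Co k → F} {U : Set (Co k)} (hU : IsOpen U)
    (h : ∀ y ∈ U, f y = g y) {x : Co k} (hx : x ∈ U) (i : Fin k) : pd i f x = pd i g x :=
  pd_congr (Filter.eventuallyEq_of_mem (hU.mem_nhds hx) h) i

theorem pd_const (c : F) (i : Fin k) (x : Co k) : pd i (fun _ => c) x = 0 := by
  simp [pd]

theorem pd_add {f g : Co k → F} {x : Co k} (hf : DifferentiableAt ℝ f x)
    (hg : DifferentiableAt ℝ g x) (i : Fin k) :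
    pd i (fun y => f y + g y) x = pd i f x + pd i g x := by
  simp only [pd, fderiv_fun_add hf hg, add_apply]

theorem pd_sum {ι : Type*} {s : Finset ι} {f : ι → Co k → F} {x : Co k}
    (hf : ∀ j ∈ s, DifferentiableAt ℝ (f j) x) (i : Fin k) :
    pd i (fun y => ∑ j ∈ s, f j y) x = ∑ j ∈ s, pd i (f j) x := by
  simp only [pd, fderiv_fun_sum hf, sum_apply]

theorem pd_smul {c : Co k → ℝ} {f : Co k → F} {x : Co k} (hc : DifferentiableAt ℝ c x)
    (hf : DifferentiableAt ℝ f x) (i : Fin k) :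
    pd i (fun y => c y • f y) x = c x • pd i f x + pd i c x • f x := by
  simp only [pd, fderiv_fun_smul hc hf, add_apply, smul_apply, ContinuousLinearMap.smulRight_apply]

theorem pd_clm (L : F →L[ℝ] G) {f : Co k → F} {x : Co k} (hf : DifferentiableAt ℝ f x)
    (i : Fin k) : pd i (fun y => L (f y)) x = L (pd i f x) := by
  have := (L.hasFDerivAt.comp x hf.hasFDerivAt).fderiv
  simp only [pd]
  erw [this]
  rfl

theorem pd_pip {f g : Co k → PE q ν} {x : Co k} (hf : DifferentiableAt ℝ f x)
    (hg : DifferentiableAt ℝ g x) (i : Fin k) :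
    pd i (fun y => pip (f y) (g y)) x = pip (pd i f x) (g x) + pip (f x) (pd i g x) := by
  have := (pipL q ν).fderiv_of_bilinear hf hg
  simp only [pipL_apply] at this
  simp only [pd, this]
  simp [ContinuousLinearMap.precompR_apply, ContinuousLinearMap.precompL_apply, pipL_apply,
    add_comm]

theorem pd_mul_left (t : PE q ν) {f : Co k → PE q ν} {x : Co k} (hf : DifferentiableAt ℝ f x)
    (i : Fin k) : pd i (fun y => t * f y) x = t * pd i f x := by
  simp only [pd, fderiv_const_mul hf]
  rfl

theorem pd_pi_apply {f : Co k → Co d} {x : Co k} (hf : DifferentiableAt ℝ f x) (i : Fin k)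
    (a : Fin d) : pd i (fun y => f y a) x = pd i f x a :=
  pd_clm (ContinuousLinearMap.proj (R := ℝ) (φ := fun _ : Fin d => ℝ) a) hf i

theorem pd_comp {φ : Co k → Co d} {f : Co d → F} {x : Co k} (hf : DifferentiableAt ℝ f (φ x))
    (hφ : DifferentiableAt ℝ φ x) (i : Fin k) :
    pd i (fun y => f (φ y)) x = ∑ a, pd i φ x a • pd a f (φ x) := by
  rw [← fderiv_eq_sum_pd, pd, pd]
  have := (hf.hasFDerivAt.comp x hφ.hasFDerivAt).fderiv
  erw [this]
  rfl

section Smooth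

variable {U : Set (Co k)} {f : Co k → F}

theorem _root_.ContDiffOn.pd (hf : ContDiffOn ℝ ∞ f U) (hU : IsOpen U) (i : Fin k) :
    ContDiffOn ℝ ∞ (pd i f) U :=
  (hf.fderiv_of_isOpen hU (m := ∞) (by simp)).clm_apply contDiffOn_const

theorem _root_.ContDiffOn.differentiableAt_of_isOpen (hf : ContDiffOn ℝ ∞ f U) (hU : IsOpen U)
    {x : Co k} (hx : x ∈ U) : DifferentiableAt ℝ f x :=
  (hf.contDiffAt (hU.mem_nhds hx)).differentiableAt (by simp)

theorem pd_pd_comm (hf : ContDiffOn ℝ ∞ f U) (hU : IsOpen U) {x : Co k} (hx : x ∈ U)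
    (i j : Fin k) : pd i (pd j f) x = pd j (pd i f) x := by
  have hsymm : IsSymmSndFDerivAt ℝ f x :=
    (hf.contDiffAt (hU.mem_nhds hx)).isSymmSndFDerivAt
      (by rw [minSmoothness_of_isRCLikeNormedField]; exact ENat.LEInfty.out)
  have hd : DifferentiableAt ℝ (fderiv ℝ f) x :=
    ((hf.fderiv_of_isOpen hU (m := ∞) (by simp)).contDiffAt (hU.mem_nhds hx)).differentiableAt
      (by simp)
  have key : ∀ i j : Fin k, pd i (pd j f) x
      = fderiv ℝ (fderiv ℝ f) x (Pi.single i 1) (Pi.single j 1) := fun i j =>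
    pd_clm (ContinuousLinearMap.apply ℝ F (Pi.single j 1 : Co k)) hd i
  rw [key, key, hsymm.eq]

theorem _root_.ContDiffOn.pip {f g : Co k → PE q ν} (hf : ContDiffOn ℝ ∞ f U)
    (hg : ContDiffOn ℝ ∞ g U) : ContDiffOn ℝ ∞ (fun y => pip (f y) (g y)) U :=
  ((pipL q ν).contDiff.comp_contDiffOn hf).clm_apply hg

theorem _root_.ContDiffOn.matrix_det {n : ℕ} {A : Co k → Matrix (Fin n) (Fin n) ℝ}
    (hA : ∀ i j, ContDiffOn ℝ ∞ (fun y => A y i j) U) :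
    ContDiffOn ℝ ∞ (fun y => (A y).det) U := by
  simp only [Matrix.det_apply]
  refine ContDiffOn.sum fun σ _ => ?_
  simp only [Units.smul_def, zsmul_eq_mul]
  exact contDiffOn_const.mul (contDiffOn_prod fun i _ => hA _ _)

theorem _root_.ContDiffOn.matrix_inv {n : ℕ} {A : Co k → Matrix (Fin n) (Fin n) ℝ}
    (hA : ∀ i j, ContDiffOn ℝ ∞ (fun y => A y i j) U) (h0 : ∀ y ∈ U, (A y).det ≠ 0)
    (i j : Fin n) : ContDiffOn ℝ ∞ (fun y => (A y)⁻¹ i j) U := by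
  simp only [Matrix.inv_def, Matrix.smul_apply, Ring.inverse_eq_inv', Matrix.adjugate_apply,
    smul_eq_mul]
  refine ((ContDiffOn.matrix_det hA).inv h0).mul (ContDiffOn.matrix_det fun a b => ?_)
  simp only [Matrix.updateRow_apply]
  split_ifs
  · exact contDiffOn_const
  · exact hA a b

end Smooth

end PartialDerivatives

/-! ### Induced metrics and their Christoffel symbols -/

section InducedMetric

variable {k q ν : ℕ} {X : Co k → PE q ν}

theorem inducedMetric_apply (X : Co k → PE q ν) (x : Co k) (i j : Fin k) :
    inducedMetric X x i j = pip (pd i X x) (pd j X x) := rfl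

theorem inducedMetric_comm (X : Co k → PE q ν) (x : Co k) (i j : Fin k) :
    inducedMetric X x i j = inducedMetric X x j i :=
  pip_comm _ _

theorem metricInner_inducedMetric (X : Co k → PE q ν) (x u v : Co k) :
    metricInner (inducedMetric X) x u v = pip (fderiv ℝ X x u) (fderiv ℝ X x v) := by
  simp only [fderiv_eq_sum_pd, pip_sum_left, pip_sum_right, pip_smul_left, pip_smul_right,
    metricInner, inducedMetric_apply, Finset.mul_sum]
  rw [Finset.sum_comm]
  exact Finset.sum_congr rfl fun i _ => Finset.sum_congr rfl fun j _ => by ring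

theorem det_inducedMetric_ne_zero {x : Co k}
    (h : ∀ v : Co k, (∀ j, pip (fderiv ℝ X x v) (pd j X x) = 0) → v = 0) :
    (inducedMetric X x).det ≠ 0 := by
  intro h0
  obtain ⟨v, hv, hv0⟩ := Matrix.exists_mulVec_eq_zero_iff.2 h0
  refine hv (h v fun j => ?_)
  refine Eq.trans ?_ (congrFun hv0 j)
  rw [fderiv_eq_sum_pd, pip_sum_left]
  refine Finset.sum_congr rfl fun i _ => ?_
  rw [pip_smul_left, ← inducedMetric_apply, inducedMetric_comm, mul_comm]

theorem inducedMetric_inv_comm (X : Co k → PE q ν) (x : Co k) (i j : Fin k) :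
    (inducedMetric X x)⁻¹ i j = (inducedMetric X x)⁻¹ j i := by
  have : (inducedMetric X x).transpose = inducedMetric X x := by
    ext a b
    exact inducedMetric_comm X x b a
  rw [← Matrix.transpose_apply (inducedMetric X x)⁻¹, Matrix.transpose_nonsing_inv, this]

theorem sum_inv_mul_inducedMetric {x : Co k} (h : (inducedMetric X x).det ≠ 0) (i j : Fin k) :
    ∑ l, (inducedMetric X x)⁻¹ i l * inducedMetric X x l j = if i = j then 1 else 0 := by
  rw [← Matrix.mul_apply, Matrix.nonsing_inv_mul _ (isUnit_iff_ne_zero.2 h), Matrix.one_apply]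

theorem linearIndependent_pd {x : Co k} (h : Function.Injective (fderiv ℝ X x)) :
    LinearIndependent ℝ fun i => pd i X x := by
  rw [Fintype.linearIndependent_iff]
  intro v hv i
  rw [← fderiv_eq_sum_pd] at hv
  exact congrFun (h (hv.trans (map_zero _).symm)) i

theorem contDiffOn_inducedMetric {U : Set (Co k)} (hU : IsOpen U) (hX : ContDiffOn ℝ ∞ X U)
    (i j : Fin k) : ContDiffOn ℝ ∞ (fun y => inducedMetric X y i j) U :=
  (hX.pd hU i).pip (hX.pd hU j)

/-- The Koszul formula for an induced metric: `Γ^c_{ab} = g^{cd} ⟨∂_a ∂_b X, ∂_d X⟩`. -/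
theorem christoffel_inducedMetric {U : Set (Co k)} (hU : IsOpen U) (hX : ContDiffOn ℝ ∞ X U)
    {x : Co k} (hx : x ∈ U) (c a b : Fin k) :
    christoffel (inducedMetric X) x c a b =
      ∑ l, (inducedMetric X x)⁻¹ c l * pip (pd a (pd b X) x) (pd l X x) := by
  have hd : ∀ i, DifferentiableAt ℝ (pd i X) x := fun i =>
    (hX.pd hU i).differentiableAt_of_isOpen hU hx
  have key : ∀ i j l, pd i (fun y => inducedMetric X y j l) x =
      pip (pd i (pd j X) x) (pd l X x) + pip (pd j X x) (pd i (pd l X) x) := fun i j l =>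
    pd_pip (hd j) (hd l) i
  rw [christoffel, Finset.mul_sum]
  refine Finset.sum_congr rfl fun l _ => ?_
  rw [key, key, key, pd_pd_comm hX hU hx b a, pd_pd_comm hX hU hx l a, pd_pd_comm hX hU hx l b,
    pip_comm (pd b X x), pip_comm (pd a X x)]
  ring

theorem sum_christoffel_mul_inducedMetric {U : Set (Co k)} (hU : IsOpen U)
    (hX : ContDiffOn ℝ ∞ X U) {x : Co k} (hx : x ∈ U) (hdet : (inducedMetric X x).det ≠ 0)
    (a b e : Fin k) :
    ∑ c, christoffel (inducedMetric X) x c a b * inducedMetric X x c e =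
      pip (pd a (pd b X) x) (pd e X x) := by
  simp only [christoffel_inducedMetric hU hX hx, Finset.sum_mul]
  rw [Finset.sum_comm]
  simp only [inducedMetric_inv_comm X x _, mul_right_comm _ (pip _ _)]
  have : ∀ l, ∑ i, (inducedMetric X x)⁻¹ l i * inducedMetric X x i e *
      pip (pd a (pd b X) x) (pd l X x) = if l = e then pip (pd a (pd b X) x) (pd l X x) else 0 := by
    intro l
    rw [← Finset.sum_mul, sum_inv_mul_inducedMetric hdet]
    simp
  calc _ = ∑ l, ∑ i, (inducedMetric X x)⁻¹ l i * inducedMetric X x i e *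
      pip (pd a (pd b X) x) (pd l X x) := by
        refine Finset.sum_congr rfl fun l _ => Finset.sum_congr rfl fun i _ => ?_
        rw [inducedMetric_inv_comm X x l i]
    _ = _ := by simp [this]

theorem contDiffOn_christoffel {U : Set (Co k)} (hU : IsOpen U) (hX : ContDiffOn ℝ ∞ X U)
    (hdet : ∀ x ∈ U, (inducedMetric X x).det ≠ 0) (c a b : Fin k) :
    ContDiffOn ℝ ∞ (fun y => christoffel (inducedMetric X) y c a b) U := by
  refine ContDiffOn.congr ?_ fun x hx => christoffel_inducedMetric hU hX hx c a b
  exact ContDiffOn.sum fun l _ => (ContDiffOn.matrix_inv (contDiffOn_inducedMetric hU hX) hdet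
    c l).mul (((hX.pd hU b).pd hU a).pip (hX.pd hU l))

end InducedMetric

/-! ### The hyperquadric of curvature `-1` -/

/-- `Y` is an immersion of the open set `V` onto an open part of the hyperquadric
`{⟨y, y⟩ = -1}`: the dimension of `V` is one less than that of the surrounding space. -/
structure IsQuadricChart {d q ν : ℕ} (V : Set (Co d)) (Y : Co d → PE q ν) : Prop where
  dim : d + 1 = q + ν
  isOpen : IsOpen V
  smooth : ContDiffOn ℝ ∞ Y V
  immersion : ∀ y ∈ V, Function.Injective (fderiv ℝ Y y)
  unit : ∀ y ∈ V, pip (Y y) (Y y) = -1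

namespace IsQuadricChart

variable {k d q ν : ℕ} {V : Set (Co d)} {Y : Co d → PE q ν}

theorem differentiableAt (hY : IsQuadricChart V Y) {y : Co d} (hy : y ∈ V) :
    DifferentiableAt ℝ Y y :=
  hY.smooth.differentiableAt_of_isOpen hY.isOpen hy

theorem differentiableAt_pd (hY : IsQuadricChart V Y) {y : Co d} (hy : y ∈ V) (a : Fin d) :
    DifferentiableAt ℝ (pd a Y) y :=
  (hY.smooth.pd hY.isOpen a).differentiableAt_of_isOpen hY.isOpen hy

theorem pip_pd_self (hY : IsQuadricChart V Y) {y : Co d} (hy : y ∈ V) (a : Fin d) :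
    pip (pd a Y y) (Y y) = 0 := by
  have h := pd_pip (hY.differentiableAt hy) (hY.differentiableAt hy) a
  rw [pd_congr_of_isOpen hY.isOpen (g := fun _ => (-1 : ℝ)) hY.unit hy, pd_const,
    pip_comm (Y y)] at h
  linarith

theorem pip_pd_pd_self (hY : IsQuadricChart V Y) {y : Co d} (hy : y ∈ V) (a b : Fin d) :
    pip (pd a (pd b Y) y) (Y y) = -inducedMetric Y y a b := by
  have h := pd_pip (hY.differentiableAt_pd hy b) (hY.differentiableAt hy) a
  rw [pd_congr_of_isOpen hY.isOpen (g := fun _ => (0 : ℝ))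
    (fun z hz => hY.pip_pd_self hz b) hy, pd_const] at h
  rw [inducedMetric_comm, inducedMetric_apply]
  linarith

theorem pip_fderiv_self (hY : IsQuadricChart V Y) {y : Co d} (hy : y ∈ V) (v : Co d) :
    pip (fderiv ℝ Y y v) (Y y) = 0 := by
  simp [fderiv_eq_sum_pd, pip_sum_left, pip_smul_left, hY.pip_pd_self hy]

theorem eq_zero_of_orthogonal (hY : IsQuadricChart V Y) {y : Co d} (hy : y ∈ V) {w : PE q ν}
    (h0 : pip w (Y y) = 0) (h : ∀ a, pip w (pd a Y y) = 0) : w = 0 := by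
  have hli := linearIndependent_cons_of_orthogonal (u := Y y)
    (linearIndependent_pd (hY.immersion y hy)) (by rw [hY.unit y hy]; norm_num)
    (fun a => by rw [pip_comm, hY.pip_pd_self hy])
  exact BiharmonicADS.eq_zero_of_orthogonal hY.dim hli (Fin.cases h0 h)

theorem det_ne_zero (hY : IsQuadricChart V Y) {y : Co d} (hy : y ∈ V) :
    (inducedMetric Y y).det ≠ 0 :=
  det_inducedMetric_ne_zero fun v hv => hY.immersion y hy <| by
    rw [map_zero]
    exact hY.eq_zero_of_orthogonal hy (hY.pip_fderiv_self hy v) hv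

/-- The Gauss formula: the normal part of the flat derivative is `⟨∂_a Y, ∂_b Y⟩ Y`. -/
theorem pd_pd_eq (hY : IsQuadricChart V Y) {y : Co d} (hy : y ∈ V) (a b : Fin d) :
    pd a (pd b Y) y = ∑ c, christoffel (inducedMetric Y) y c a b • pd c Y y
      + inducedMetric Y y a b • Y y := by
  rw [← sub_eq_zero]
  refine hY.eq_zero_of_orthogonal hy ?_ fun e => ?_
  · simp [pip_sub_left, pip_add_left, pip_sum_left, pip_smul_left, hY.pip_pd_self hy,
      hY.pip_pd_pd_self hy, hY.unit y hy]
  · have := sum_christoffel_mul_inducedMetric hY.isOpen hY.smooth hy (hY.det_ne_zero hy) a b e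
    simp only [inducedMetric_apply] at this
    simp [pip_sub_left, pip_add_left, pip_sum_left, pip_smul_left, this,
      pip_comm (Y y), hY.pip_pd_self hy]

theorem exists_pd_pd_pd_eq (hY : IsQuadricChart V Y) {y : Co d} (hy : y ∈ V) (a b c : Fin d) :
    ∃ z : ℝ, pd a (pd b (pd c Y)) y =
      ∑ l, (pd a (fun y => christoffel (inducedMetric Y) y l b c) y
        + ∑ e, christoffel (inducedMetric Y) y l a e * christoffel (inducedMetric Y) y e b c)
          • pd l Y y + inducedMetric Y y b c • pd a Y y + z • Y y := by
  have hΓ : ∀ l, DifferentiableAt ℝ (fun y => christoffel (inducedMetric Y) y l b c) y :=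
    fun l => (contDiffOn_christoffel hY.isOpen hY.smooth (fun z hz => hY.det_ne_zero hz)
      l b c).differentiableAt_of_isOpen hY.isOpen hy
  have hh : DifferentiableAt ℝ (fun y => inducedMetric Y y b c) y :=
    (contDiffOn_inducedMetric hY.isOpen hY.smooth b c).differentiableAt_of_isOpen hY.isOpen hy
  refine ⟨∑ l, christoffel (inducedMetric Y) y l b c * inducedMetric Y y a l
    + pd a (fun y => inducedMetric Y y b c) y, ?_⟩
  rw [pd_congr_of_isOpen hY.isOpen (fun z hz => hY.pd_pd_eq hz b c) hy,
    pd_add (DifferentiableAt.fun_sum fun l _ => (hΓ l).fun_smul (hY.differentiableAt_pd hy l))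
      (hh.fun_smul (hY.differentiableAt hy)),
    pd_sum fun l _ => (hΓ l).fun_smul (hY.differentiableAt_pd hy l),
    pd_smul hh (hY.differentiableAt hy)]
  simp only [pd_smul (hΓ _) (hY.differentiableAt_pd hy _), hY.pd_pd_eq hy a, add_smul,
    Finset.sum_add_distrib, smul_add, Finset.smul_sum, smul_smul, Finset.sum_smul]
  rw [Finset.sum_comm (γ := Fin d)]
  simp only [mul_comm (christoffel _ _ _ b c) (christoffel _ _ _ _ _)]
  abel

/-- The hyperquadric has constant curvature `-1`. -/
theorem riemann_eq (hY : IsQuadricChart V Y) {y : Co d} (hy : y ∈ V) (l c a b : Fin d) :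
    riemann (inducedMetric Y) y l c a b =
      inducedMetric Y y a c * (if l = b then 1 else 0)
        - inducedMetric Y y b c * (if l = a then 1 else 0) := by
  obtain ⟨z, hz⟩ := hY.exists_pd_pd_pd_eq hy a b c
  obtain ⟨z', hz'⟩ := hY.exists_pd_pd_pd_eq hy b a c
  have hcomm := pd_pd_comm (hY.smooth.pd hY.isOpen c) hY.isOpen hy a b
  rw [hz, hz'] at hcomm
  have hpd : ∀ a, pd a Y y = ∑ l, (if l = a then (1 : ℝ) else 0) • pd l Y y := by simp
  -- pairing with `Y` shows that the normal components agree
  have hzz : z = z' := by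
    have := congrArg (fun w => pip w (Y y)) hcomm
    simpa [pip_add_left, pip_sum_left, pip_smul_left, hY.pip_pd_self hy, hY.unit y hy] using this
  subst hzz
  have hli := Fintype.linearIndependent_iff.1 (linearIndependent_pd (hY.immersion y hy))
    (fun l => riemann (inducedMetric Y) y l c a b -
      (inducedMetric Y y a c * (if l = b then 1 else 0)
        - inducedMetric Y y b c * (if l = a then 1 else 0))) ?_ l
  · exact sub_eq_zero.1 hli
  · rw [add_left_inj, hpd a, hpd b, Finset.smul_sum, Finset.smul_sum,
      ← Finset.sum_add_distrib, ← Finset.sum_add_distrib, ← sub_eq_zero,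
      ← Finset.sum_sub_distrib] at hcomm
    rw [← hcomm]
    refine Finset.sum_congr rfl fun l _ => ?_
    simp only [riemann, smul_smul, ← add_smul, ← sub_smul, Finset.sum_sub_distrib]
    congr 1
    ring

theorem curvature_eq (hY : IsQuadricChart V Y) {y : Co d} (hy : y ∈ V) (u v w : Co d) :
    curvature (inducedMetric Y) y u v w =
      metricInner (inducedMetric Y) y u w • v - metricInner (inducedMetric Y) y v w • u := by
  funext l
  simp only [curvature, hY.riemann_eq hy, metricInner, Pi.sub_apply, Pi.smul_apply, smul_eq_mul,
    Finset.sum_mul]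
  simp only [sub_mul, Finset.sum_sub_distrib]
  congr 1
  · refine Finset.sum_congr rfl fun a _ => ?_
    rw [Finset.sum_comm]
    refine Finset.sum_congr rfl fun c _ => ?_
    simp
    ring
  · simp only [mul_ite, ite_mul, mul_one, mul_zero, zero_mul]
    rw [Finset.sum_comm]
    refine Finset.sum_congr rfl fun b _ => ?_
    rw [Finset.sum_comm]
    refine Finset.sum_congr rfl fun c _ => ?_
    simp
    ring

/-- In the flat ambient space the pulled back connection is the flat derivative, corrected by its
component along the position vector. -/
theorem fderiv_covAlong (hY : IsQuadricChart V Y) {φ W : Co k → Co d} {x : Co k}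
    (hφV : φ x ∈ V) (hφ : DifferentiableAt ℝ φ x) (hW : DifferentiableAt ℝ W x) (i : Fin k) :
    fderiv ℝ Y (φ x) (covAlong (inducedMetric Y) φ W i x) =
      pd i (fun z => fderiv ℝ Y (φ z) (W z)) x
        - pip (fderiv ℝ Y (φ x) (pd i φ x)) (fderiv ℝ Y (φ x) (W x)) • Y (φ x) := by
  have hWc : ∀ c, DifferentiableAt ℝ (fun z => W z c) x := differentiableAt_pi.1 hW
  have hYc : ∀ c, DifferentiableAt ℝ (fun z => pd c Y (φ z)) x := fun c =>
    DifferentiableAt.comp x (hY.differentiableAt_pd hφV c) hφ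
  rw [← metricInner_inducedMetric]
  simp only [fderiv_eq_sum_pd, covAlong]
  rw [pd_sum fun c _ => (hWc c).fun_smul (hYc c)]
  simp only [pd_smul (hWc _) (hYc _), pd_comp (hY.differentiableAt_pd hφV _) hφ,
    hY.pd_pd_eq hφV, pd_pi_apply hW, add_smul, Finset.sum_add_distrib, smul_add, Finset.smul_sum,
    smul_smul, Finset.sum_smul, metricInner]
  have h1 : ∑ c, ∑ a, ∑ b, (christoffel (inducedMetric Y) (φ x) c a b * pd i φ x a * W x b)
      • pd c Y (φ x) = ∑ b, ∑ a, ∑ c,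
      (W x b * (pd i φ x a * christoffel (inducedMetric Y) (φ x) c a b)) • pd c Y (φ x) := by
    rw [Finset.sum_comm, Finset.sum_congr rfl fun a _ => Finset.sum_comm, Finset.sum_comm]
    exact Finset.sum_congr rfl fun b _ => Finset.sum_congr rfl fun a _ =>
      Finset.sum_congr rfl fun c _ => by congr 1; ring
  have h2 : ∑ a, ∑ b, (inducedMetric Y (φ x) a b * pd i φ x a * W x b) • Y (φ x) =
      ∑ b, ∑ a, (W x b * (pd i φ x a * inducedMetric Y (φ x) a b)) • Y (φ x) := by
    rw [Finset.sum_comm]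
    exact Finset.sum_congr rfl fun b _ => Finset.sum_congr rfl fun a _ => by congr 1; ring
  rw [h1, h2]
  abel

end IsQuadricChart

namespace IsQuadricChart

variable {k d q ν : ℕ} {V : Set (Co d)} {Y : Co d → PE q ν}

/-- Coordinates of a tangent vector of the hyperquadric, recovered from its scalar products with
the coordinate frame. -/
theorem eq_sum_inv_mul_pip (hY : IsQuadricChart V Y) {y : Co d} (hy : y ∈ V) (v : Co d)
    (c : Fin d) : v c = ∑ e, (inducedMetric Y y)⁻¹ c e * pip (fderiv ℝ Y y v) (pd e Y y) := by
  simp only [fderiv_eq_sum_pd, pip_sum_left, pip_smul_left, Finset.mul_sum]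
  rw [Finset.sum_comm]
  have : ∀ l, ∑ e, (inducedMetric Y y)⁻¹ c e * (v l * pip (pd l Y y) (pd e Y y)) =
      v l * if c = l then 1 else 0 := by
    intro l
    rw [← sum_inv_mul_inducedMetric (hY.det_ne_zero hy), Finset.mul_sum]
    refine Finset.sum_congr rfl fun e _ => ?_
    rw [inducedMetric_comm, inducedMetric_apply]
    ring
  simp [this]

theorem exists_fderiv_eq (hY : IsQuadricChart V Y) {y : Co d} (hy : y ∈ V) {w : PE q ν}
    (hw : pip w (Y y) = 0) : ∃ v, fderiv ℝ Y y v = w := by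
  refine ⟨fun c => ∑ e, (inducedMetric Y y)⁻¹ c e * pip w (pd e Y y), ?_⟩
  rw [← sub_eq_zero]
  refine hY.eq_zero_of_orthogonal hy ?_ fun a => ?_
  · rw [pip_sub_left, hY.pip_fderiv_self hy, hw, sub_zero]
  · rw [pip_sub_left, sub_eq_zero, fderiv_eq_sum_pd, pip_sum_left]
    simp only [pip_smul_left, Finset.sum_mul]
    rw [Finset.sum_comm]
    have : ∀ e, ∑ c, (inducedMetric Y y)⁻¹ c e * pip w (pd e Y y) * pip (pd c Y y) (pd a Y y) =
        pip w (pd e Y y) * if e = a then 1 else 0 := by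
      intro e
      rw [← sum_inv_mul_inducedMetric (hY.det_ne_zero hy), Finset.mul_sum]
      refine Finset.sum_congr rfl fun c _ => ?_
      rw [inducedMetric_inv_comm Y y e c, inducedMetric_apply]
      ring
    simp [this]

/-- A vector field along a map into the hyperquadric is smooth as soon as it is smooth as a map
into the flat ambient space. -/
theorem contDiffOn_of_fderiv (hY : IsQuadricChart V Y) {U : Set (Co k)} {φ W : Co k → Co d}
    {w : Co k → PE q ν} (hφV : Set.MapsTo φ U V) (hφ : ContDiffOn ℝ ∞ φ U)
    (hw : ContDiffOn ℝ ∞ w U) (hW : ∀ x ∈ U, fderiv ℝ Y (φ x) (W x) = w x) :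
    ContDiffOn ℝ ∞ W U := by
  refine contDiffOn_pi.2 fun c => ?_
  refine ContDiffOn.congr (f := fun x => ∑ e, (inducedMetric Y (φ x))⁻¹ c e *
    pip (w x) (pd e Y (φ x))) ?_ fun x hx => ?_
  · refine ContDiffOn.sum fun e _ => ContDiffOn.mul ?_ ?_
    · exact (ContDiffOn.matrix_inv (contDiffOn_inducedMetric hY.isOpen hY.smooth)
        (fun y hy => hY.det_ne_zero hy) c e).comp hφ hφV
    · exact hw.pip ((hY.smooth.pd hY.isOpen e).comp hφ hφV)
  · rw [hY.eq_sum_inv_mul_pip (hφV hx) (W x) c, hW x hx]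

end IsQuadricChart

namespace IsLocalParam

variable {k q ν : ℕ} {S : Set (PE q ν)} {U : Set (Co k)} {X : Co k → PE q ν}

theorem mem (hX : IsLocalParam S U X)
    {x : Co k} (hx : x ∈ U) : X x ∈ S := by
  obtain ⟨W, -, hW⟩ := hX.image_eq
  exact (hW ▸ Set.mem_image_of_mem X hx : X x ∈ S ∩ W).1

theorem differentiableAt {S : Set (PE q ν)}
    (hX : IsLocalParam S U X) {x : Co k} (hx : x ∈ U) : DifferentiableAt ℝ X x :=
  hX.smooth.differentiableAt_of_isOpen hX.isOpen hx

theorem differentiableAt_pd {S : Set (PE q ν)}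
    (hX : IsLocalParam S U X) {x : Co k} (hx : x ∈ U) (i : Fin k) :
    DifferentiableAt ℝ (pd i X) x :=
  (hX.smooth.pd hX.isOpen i).differentiableAt_of_isOpen hX.isOpen hx

/-- A function that is constant on `S` has vanishing partial derivatives in a parametrization. -/
theorem pd_eq_zero (hX : IsLocalParam S U X)
    {F : PE q ν → ℝ} {κ : ℝ} (hF : ∀ p ∈ S, F p = κ) {x : Co k} (hx : x ∈ U) (i : Fin k) :
    pd i (fun z => F (X z)) x = 0 := by
  rw [pd_congr_of_isOpen hX.isOpen (g := fun _ => κ) (fun z hz => hF _ (hX.mem hz)) hx, pd_const]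

end IsLocalParam

/-! ### Hypersurfaces whose unit normal is a diagonal affine function of the position -/

/-- `M` is a `k`-dimensional hypersurface of the hyperquadric `{⟨y, y⟩ = -1}` for which
`η(p) = t * p + c` is a time-like unit normal at `p ∈ M`, where `t` acts diagonally on the ambient
coordinates and `c` is a constant vector whose scalar product is constant on `M`. The shape operator
is then multiplication by `t`. The fields `trace` and `trace_sq` say that its trace is `f` and that
the trace of its square is `a`: the trace of `t` on the ambient space is corrected by the
contributions of the time-like directions `p` and `η`. The field `balance` says that
`trace ∇²η = a η`, its left-hand side being what the Gauss formula gives for `trace ∇²η`. -/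
structure HasDiagonalNormal {q ν : ℕ} (k : ℕ) (M : Set (PE q ν)) (t c : PE q ν) (f a : ℝ) :
    Prop where
  dim : k + 2 = q + ν
  unit : ∀ p ∈ M, pip p p = -1
  normal : ∀ p ∈ M, pip (t * p + c) p = 0
  unit_normal : ∀ p ∈ M, pip (t * p + c) (t * p + c) = -1
  const : ∃ κ, ∀ p ∈ M, pip c p = κ
  trace : ∀ p ∈ M, ∑ i, t i + pip (t * p) p + pip (t * (t * p + c)) (t * p + c) = f
  trace_sq : ∀ p ∈ M, ∑ i, (t * t) i + pip (t * t * p) p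
    + pip (t * t * (t * p + c)) (t * p + c) = a
  balance : ∀ p ∈ M, (k : ℝ) • (t * p) + f • (t * (t * p + c)) - f • p = a • (t * p + c)

namespace HasDiagonalNormal

variable {k q ν : ℕ} {M : Set (PE q ν)} {t c : PE q ν} {f a : ℝ} {U : Set (Co k)}
  {X : Co k → PE q ν}

section Parametrization

variable (D : HasDiagonalNormal k M t c f a) (hX : IsLocalParam M U X) {x : Co k} (hx : x ∈ U)
include D hX hx

theorem pip_pd_self (i : Fin k) : pip (pd i X x) (X x) = 0 := by
  have h := hX.pd_eq_zero (F := fun p => pip p p) D.unit hx i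
  rw [pd_pip (hX.differentiableAt hx) (hX.differentiableAt hx), pip_comm (X x)] at h
  linarith

omit D in
theorem pd_normal (i : Fin k) : pd i (fun z => t * X z + c) x = t * pd i X x := by
  rw [pd_add ((hX.differentiableAt hx).const_mul t) (differentiableAt_const c),
    pd_mul_left t (hX.differentiableAt hx), pd_const, add_zero]

omit D in
theorem differentiableAt_normal : DifferentiableAt ℝ (fun z => t * X z + c) x :=
  ((hX.differentiableAt hx).const_mul t).add_const c

theorem pip_pd_const (i : Fin k) : pip (pd i X x) c = 0 := by
  obtain ⟨κ, hκ⟩ := D.const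
  have h := hX.pd_eq_zero hκ hx i
  rwa [pd_pip (differentiableAt_const c) (hX.differentiableAt hx), pd_const, pip_zero_left,
    zero_add, pip_comm] at h

theorem pip_pd_normal (i : Fin k) : pip (pd i X x) (t * X x + c) = 0 := by
  have h := hX.pd_eq_zero (F := fun p => pip (t * p + c) p) D.normal hx i
  rw [pd_pip (differentiableAt_normal hX hx) (hX.differentiableAt hx), pd_normal hX hx,
    pip_mul_left, pip_comm _ (pd i X x), pip_add_right, D.pip_pd_const hX hx, add_zero] at h
  rw [pip_add_right, D.pip_pd_const hX hx]
  linarith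

theorem pip_mul_pd_self (i : Fin k) : pip (t * pd i X x) (X x) = 0 := by
  have h := D.pip_pd_normal hX hx i
  rwa [pip_add_right, D.pip_pd_const hX hx, add_zero, ← pip_mul_left] at h

theorem pip_mul_pd_normal (i : Fin k) : pip (t * pd i X x) (t * X x + c) = 0 := by
  have h := hX.pd_eq_zero (F := fun p => pip (t * p + c) (t * p + c)) D.unit_normal hx i
  rw [pd_pip (differentiableAt_normal hX hx) (differentiableAt_normal hX hx), pd_normal hX hx,
    pip_comm (t * X x + c)] at h
  linarith

theorem pip_pd_pd_self (i j : Fin k) :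
    pip (pd i (pd j X) x) (X x) = -inducedMetric X x i j := by
  have h := pd_pip (hX.differentiableAt_pd hx j) (hX.differentiableAt hx) i
  rw [pd_congr_of_isOpen hX.isOpen (g := fun _ => (0 : ℝ))
    (fun z hz => D.pip_pd_self hX hz j) hx, pd_const] at h
  rw [inducedMetric_comm, inducedMetric_apply]
  linarith

theorem pip_pd_pd_normal (i j : Fin k) :
    pip (pd i (pd j X) x) (t * X x + c) = -pip (t * pd i X x) (pd j X x) := by
  have h := pd_pip (hX.differentiableAt_pd hx j) (differentiableAt_normal (t := t) (c := c) hX hx) i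
  rw [pd_congr_of_isOpen hX.isOpen (g := fun _ => (0 : ℝ))
    (fun z hz => D.pip_pd_normal hX hz j) hx, pd_const, pd_normal hX hx, pip_comm (pd j X x)] at h
  linarith

theorem eq_zero_of_orthogonal {w : PE q ν} (h0 : pip w (X x) = 0)
    (h1 : pip w (t * X x + c) = 0) (h : ∀ i, pip w (pd i X x) = 0) : w = 0 := by
  have hli := linearIndependent_cons_of_orthogonal (u := X x)
    (linearIndependent_pd (hX.immersion x hx)) (by rw [D.unit _ (hX.mem hx)]; norm_num)
    (fun a => by rw [pip_comm, D.pip_pd_self hX hx])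
  have hli' := linearIndependent_cons_of_orthogonal (u := t * X x + c) hli
    (by rw [D.unit_normal _ (hX.mem hx)]; norm_num)
    (Fin.cases (D.normal _ (hX.mem hx))
      (fun a => by rw [Fin.cons_succ, pip_comm, D.pip_pd_normal hX hx]))
  exact BiharmonicADS.eq_zero_of_orthogonal D.dim hli' (Fin.cases h1 (Fin.cases h0 h))

theorem det_ne_zero : (inducedMetric X x).det ≠ 0 := by
  refine det_inducedMetric_ne_zero fun v hv => hX.immersion x hx ?_
  rw [map_zero]
  refine D.eq_zero_of_orthogonal hX hx ?_ ?_ hv <;>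
    simp [fderiv_eq_sum_pd, pip_sum_left, pip_smul_left, D.pip_pd_self hX hx,
      D.pip_pd_normal hX hx]

/-- The Gauss formula in the flat ambient space. -/
theorem pd_pd_eq (i j : Fin k) :
    pd i (pd j X) x = ∑ l, christoffel (inducedMetric X) x l i j • pd l X x
      + inducedMetric X x i j • X x + pip (t * pd i X x) (pd j X x) • (t * X x + c) := by
  have hp := hX.mem hx
  rw [← sub_eq_zero]
  refine D.eq_zero_of_orthogonal hX hx ?_ ?_ fun e => ?_
  · rw [pip_sub_left, pip_add_left, pip_add_left, pip_smul_left, pip_smul_left, D.normal _ hp,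
      D.unit _ hp, D.pip_pd_pd_self hX hx]
    simp [pip_sum_left, pip_smul_left, D.pip_pd_self hX hx]
  · simp only [pip_sub_left, pip_add_left _ _ (t * X x + c), pip_sum_left, pip_smul_left,
      D.pip_pd_normal hX hx, D.pip_pd_pd_normal hX hx, pip_comm (X x), D.normal _ hp]
    rw [← pip_add_left, D.unit_normal _ hp]
    simp
  · have := sum_christoffel_mul_inducedMetric hX.isOpen hX.smooth hx (D.det_ne_zero hX hx) i j e
    simp only [inducedMetric_apply] at this
    rw [pip_sub_left, pip_add_left, pip_add_left, pip_smul_left, pip_smul_left,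
      pip_comm (X x), pip_comm (t * X x + c), D.pip_pd_self hX hx, D.pip_pd_normal hX hx]
    simp [pip_sum_left, pip_smul_left, this]

/-- Expansion of a vector in the frame consisting of the coordinate fields, the position vector
and the normal. -/
theorem eq_sum_frame (w : PE q ν) :
    w = ∑ i, ∑ j, ((inducedMetric X x)⁻¹ i j * pip w (pd i X x)) • pd j X x
      - pip w (X x) • X x - pip w (t * X x + c) • (t * X x + c) := by
  have hp := hX.mem hx
  rw [← sub_eq_zero]
  refine D.eq_zero_of_orthogonal hX hx ?_ ?_ fun e => ?_
  · rw [pip_sub_left, pip_sub_left, pip_sub_left, pip_smul_left, pip_smul_left, D.unit _ hp,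
      D.normal _ hp]
    simp [pip_sum_left, pip_smul_left, D.pip_pd_self hX hx]
  · rw [pip_sub_left, pip_sub_left, pip_sub_left, pip_smul_left, pip_smul_left,
      D.unit_normal _ hp, pip_comm (X x), D.normal _ hp]
    simp [pip_sum_left, pip_smul_left, D.pip_pd_normal hX hx]
  · rw [pip_sub_left, pip_sub_left, pip_sub_left, pip_smul_left, pip_smul_left,
      pip_comm (X x), pip_comm (t * X x + c), D.pip_pd_self hX hx, D.pip_pd_normal hX hx]
    simp only [pip_sum_left, pip_smul_left, mul_zero, sub_zero]
    have : ∀ i, ∑ j, (inducedMetric X x)⁻¹ i j * pip w (pd i X x) * pip (pd j X x) (pd e X x) =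
        pip w (pd i X x) * if i = e then 1 else 0 := by
      intro i
      rw [← sum_inv_mul_inducedMetric (D.det_ne_zero hX hx), Finset.mul_sum]
      refine Finset.sum_congr rfl fun j _ => ?_
      rw [inducedMetric_apply]
      ring
    simp [this]

/-- The trace of a diagonal endomorphism of the ambient space, computed in the frame. -/
theorem sum_eq_trace_frame (u : PE q ν) :
    ∑ i, ∑ j, (inducedMetric X x)⁻¹ i j * pip (u * pd i X x) (pd j X x) =
      ∑ α, u α + pip (u * X x) (X x) + pip (u * (t * X x + c)) (t * X x + c) := by
  set η := t * X x + c with hη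
  have key : ∀ α, u α = ∑ i, ∑ j, (inducedMetric X x)⁻¹ i j *
      (sgn α * (u α * pd i X x α * pd j X x α))
      - sgn α * (u α * X x α * X x α) - sgn α * (u α * η α * η α) := by
    intro α
    have h := congrFun (D.eq_sum_frame hX hx (Pi.single α 1)) α
    simp only [← hη, pip_comm (Pi.single α 1), pip_single, Pi.sub_apply, Finset.sum_apply,
      Pi.smul_apply, smul_eq_mul, Pi.single_eq_same] at h
    calc u α = u α * 1 := (mul_one _).symm
      _ = _ := by
        rw [h, mul_sub, mul_sub, Finset.mul_sum]
        simp only [Finset.mul_sum]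
        congr 1
        · congr 1
          · exact Finset.sum_congr rfl fun i _ => Finset.sum_congr rfl fun j _ => by ring
          · ring
        · ring
  have h2 : ∑ α, u α = ∑ i, ∑ j, (inducedMetric X x)⁻¹ i j * pip (u * pd i X x) (pd j X x)
      - pip (u * X x) (X x) - pip (u * η) η := by
    rw [Finset.sum_congr rfl fun α _ => key α]
    simp only [Finset.sum_sub_distrib, pip_eq_sum, Pi.mul_apply, Finset.mul_sum]
    congr 2
    rw [Finset.sum_comm]
    refine Finset.sum_congr rfl fun i _ => ?_
    rw [Finset.sum_comm]
  rw [h2]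
  ring

theorem trace_shape :
    ∑ i, ∑ j, (inducedMetric X x)⁻¹ i j * pip (t * pd i X x) (pd j X x) = f := by
  rw [D.sum_eq_trace_frame hX hx, D.trace _ (hX.mem hx)]

theorem trace_shape_sq :
    ∑ i, ∑ j, (inducedMetric X x)⁻¹ i j * pip (t * pd i X x) (t * pd j X x) = a := by
  rw [← D.trace_sq _ (hX.mem hx), ← D.sum_eq_trace_frame hX hx]
  simp only [mul_assoc, ← pip_mul_left]

theorem sum_inv_mul_pip_mul_pd (i : Fin k) :
    ∑ j, ∑ l, ((inducedMetric X x)⁻¹ j l * pip (t * pd i X x) (pd j X x)) • pd l X x =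
      t * pd i X x := by
  have h := D.eq_sum_frame hX hx (t * pd i X x)
  rwa [D.pip_mul_pd_self hX hx, D.pip_mul_pd_normal hX hx, zero_smul, zero_smul, sub_zero,
    sub_zero, eq_comm] at h

theorem trace_metric :
    ∑ i, ∑ j, (inducedMetric X x)⁻¹ i j * inducedMetric X x i j = k := by
  have := sum_inv_mul_inducedMetric (D.det_ne_zero hX hx)
  calc _ = ∑ i, ∑ j, (inducedMetric X x)⁻¹ i j * inducedMetric X x j i :=
        Finset.sum_congr rfl fun i _ => Finset.sum_congr rfl fun j _ => by
          rw [inducedMetric_comm]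
    _ = _ := by simp [this]

end Parametrization

end HasDiagonalNormal

namespace LocalRep

variable {k q ν : ℕ} {M N : Set (PE q ν)} (R : LocalRep k (k + 1) M N)

theorem isQuadricChart (hdim : k + 2 = q + ν) (hN : ∀ p ∈ N, pip p p = -1) :
    IsQuadricChart R.V R.Y where
  dim := hdim
  isOpen := R.paramN.isOpen
  smooth := R.paramN.smooth
  immersion := R.paramN.immersion
  unit _ hy := hN _ (R.paramN.mem hy)

variable {R} {x : Co k}

theorem differentiableAt_φ (hx : x ∈ R.U) : DifferentiableAt ℝ R.φ x :=
  R.smooth.differentiableAt_of_isOpen R.paramM.isOpen hx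

theorem fderiv_pd_φ (hx : x ∈ R.U) (i : Fin k) :
    fderiv ℝ R.Y (R.φ x) (pd i R.φ x) = pd i R.X x := by
  rw [pd_congr_of_isOpen R.paramM.isOpen R.comp_eq hx,
    pd_comp (R.paramN.differentiableAt (R.mapsTo hx)) (differentiableAt_φ hx), fderiv_eq_sum_pd]

end LocalRep

namespace HasDiagonalNormal

variable {k q ν : ℕ} {M N : Set (PE q ν)} {t c : PE q ν} {f a : ℝ}
  (D : HasDiagonalNormal k M t c f a) (hN : ∀ p ∈ N, pip p p = -1)
  {R : LocalRep k (k + 1) M N} {x : Co k} (hx : x ∈ R.U)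
include D hN hx

/-- A vector field along the inclusion is determined by its image in the flat ambient space. -/
theorem eq_of_fderiv_eq {v w : Co (k + 1)}
    (h : fderiv ℝ R.Y (R.φ x) v = fderiv ℝ R.Y (R.φ x) w) : v = w :=
  (R.isQuadricChart D.dim hN).immersion _ (R.mapsTo hx) h

theorem fderiv_covAlong {W : Co k → Co (k + 1)} {w : Co k → PE q ν}
    (hw : ContDiffOn ℝ ∞ w R.U)
    (hW : ∀ z ∈ R.U, fderiv ℝ R.Y (R.φ z) (W z) = w z) (i : Fin k) :
    fderiv ℝ R.Y (R.φ x) (covAlong R.h R.φ W i x) =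
      pd i w x - pip (pd i R.X x) (w x) • R.X x := by
  have hY := R.isQuadricChart D.dim hN
  have hWd := (hY.contDiffOn_of_fderiv R.mapsTo R.smooth hw hW).differentiableAt_of_isOpen
    R.paramM.isOpen hx
  rw [LocalRep.h, hY.fderiv_covAlong (R.mapsTo hx) (LocalRep.differentiableAt_φ hx) hWd,
    pd_congr_of_isOpen R.paramM.isOpen hW hx, hW x hx, LocalRep.fderiv_pd_φ hx,
    ← R.comp_eq x hx]

/-- The second fundamental form is `⟨t * X_i, X_j⟩ η`. -/
theorem fderiv_secondFundForm (i j : Fin k) :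
    fderiv ℝ R.Y (R.φ x) (R.B x i j) =
      pip (t * pd i R.X x) (pd j R.X x) • (t * R.X x + c) := by
  rw [LocalRep.B, secondFundForm, map_sub, D.fderiv_covAlong hN hx
    (R.paramM.smooth.pd R.paramM.isOpen j) (fun z hz => LocalRep.fderiv_pd_φ hz j)]
  simp only [map_sum, map_smul, LocalRep.fderiv_pd_φ hx]
  rw [D.pd_pd_eq R.paramM hx i j, LocalRep.g, ← inducedMetric_apply]
  abel

theorem fderiv_tension :
    fderiv ℝ R.Y (R.φ x) (tension R.g R.h R.φ x) = f • (t * R.X x + c) := by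
  have := D.fderiv_secondFundForm hN hx
  simp only [LocalRep.B] at this
  simp only [tension, map_sum, map_smul, this, smul_smul, ← Finset.sum_smul]
  rw [← D.trace_shape R.paramM hx]
  rfl

omit D hN hx in
theorem contDiffOn_smul_normal :
    ContDiffOn ℝ ∞ (fun z => f • (t * R.X z + c)) R.U :=
  ((contDiffOn_const.mul R.paramM.smooth).add contDiffOn_const).const_smul f

theorem fderiv_covAlong_tension (j : Fin k) :
    fderiv ℝ R.Y (R.φ x) (covAlong R.h R.φ (tension R.g R.h R.φ) j x) =
      f • (t * pd j R.X x) := by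
  rw [D.fderiv_covAlong hN hx contDiffOn_smul_normal (fun z hz => D.fderiv_tension hN hz),
    pip_smul_right, D.pip_pd_normal R.paramM hx, mul_zero, zero_smul, sub_zero]
  have := pd_smul (differentiableAt_const f) (differentiableAt_normal (t := t) (c := c)
    R.paramM hx) j
  rw [this, pd_const, zero_smul, add_zero, pd_normal R.paramM hx]

theorem fderiv_covAlong_covAlong_tension (i j : Fin k) :
    fderiv ℝ R.Y (R.φ x) (covAlong R.h R.φ (covAlong R.h R.φ (tension R.g R.h R.φ) j) i x) =
      f • (t * pd i (pd j R.X) x - pip (t * pd i R.X x) (pd j R.X x) • R.X x) := by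
  have hs : ContDiffOn ℝ ∞ (fun z => f • (t * pd j R.X z)) R.U :=
    (contDiffOn_const.mul (R.paramM.smooth.pd R.paramM.isOpen j)).const_smul f
  rw [D.fderiv_covAlong hN hx hs (fun z hz => D.fderiv_covAlong_tension hN hz j)]
  have := pd_smul (differentiableAt_const f)
    ((R.paramM.differentiableAt_pd hx j).const_mul t) i
  rw [this, pd_const, zero_smul, add_zero, pd_mul_left t (R.paramM.differentiableAt_pd hx j),
    pip_smul_right, ← pip_mul_left, smul_sub, smul_smul]

theorem fderiv_traceHessAlong_tension :
    fderiv ℝ R.Y (R.φ x) (traceHessAlong R.g R.h R.φ (tension R.g R.h R.φ) x) =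
      (f * a) • (t * R.X x + c) := by
  have hterm : ∀ i j, t * pd i (pd j R.X) x - pip (t * pd i R.X x) (pd j R.X x) • R.X x
      - ∑ l, christoffel R.g x l i j • (t * pd l R.X x) =
      inducedMetric R.X x i j • (t * R.X x)
        + pip (t * pd i R.X x) (pd j R.X x) • (t * (t * R.X x + c) - R.X x) := by
    intro i j
    rw [D.pd_pd_eq R.paramM hx i j]
    simp only [mul_add, mul_smul_comm, Finset.mul_sum, smul_sub, smul_add, LocalRep.g]
    abel
  simp only [traceHessAlong, map_sum, map_smul, map_sub,
    D.fderiv_covAlong_covAlong_tension hN hx, D.fderiv_covAlong_tension hN hx]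
  simp only [smul_comm _ f, ← Finset.smul_sum, ← smul_sub, hterm]
  rw [mul_smul f a, ← D.balance _ (R.paramM.mem hx)]
  congr 1
  simp only [smul_add (_ : ℝ) (_ • _) (_ • _), smul_smul, Finset.sum_add_distrib,
    ← Finset.sum_smul, LocalRep.g]
  rw [D.trace_metric R.paramM hx, D.trace_shape R.paramM hx, smul_sub, add_sub_assoc]

omit D hN hx in
theorem metricInner_eq (v w : Co (k + 1)) :
    metricInner R.h (R.φ x) v w =
      pip (fderiv ℝ R.Y (R.φ x) v) (fderiv ℝ R.Y (R.φ x) w) :=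
  metricInner_inducedMetric _ _ _ _

/-- The second tension field is `f (a - k) η`: the curvature of the hyperquadric contributes
`k τ(φ)`. -/
theorem fderiv_bitension :
    fderiv ℝ R.Y (R.φ x) (bitension R.g R.h R.φ x) = (f * (a - k)) • (t * R.X x + c) := by
  have hcurv : ∀ i j, fderiv ℝ R.Y (R.φ x) (curvature R.h (R.φ x) (pd i R.φ x)
      (tension R.g R.h R.φ x) (pd j R.φ x)) =
      inducedMetric R.X x i j • f • (t * R.X x + c) := by
    intro i j
    have h := (R.isQuadricChart D.dim hN).curvature_eq (R.mapsTo hx) (pd i R.φ x)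
      (tension R.g R.h R.φ x) (pd j R.φ x)
    have hτ := D.fderiv_tension hN hx
    rw [← LocalRep.h] at h
    rw [h, map_sub, map_smul, map_smul, metricInner_eq, metricInner_eq,
      hτ, LocalRep.fderiv_pd_φ hx, LocalRep.fderiv_pd_φ hx,
      pip_smul_left, pip_comm (t * R.X x + c), D.pip_pd_normal R.paramM hx, mul_zero, zero_smul,
      sub_zero, inducedMetric_apply]
  simp only [bitension, map_sub, map_sum, map_smul, D.fderiv_traceHessAlong_tension hN hx, hcurv,
    smul_smul, ← Finset.sum_smul, ← sub_smul]
  congr 1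
  rw [mul_sub, ← D.trace_metric R.paramM hx, Finset.mul_sum]
  congr 1
  refine Finset.sum_congr rfl fun i _ => ?_
  rw [Finset.mul_sum]
  exact Finset.sum_congr rfl fun j _ => by rw [LocalRep.g]; ring

/-- The normal `t * p + c`, written in the coordinates of the ambient hyperquadric. -/
theorem exists_isUnitNormal : ∃ η, R.IsUnitNormal x η ∧
    ∀ i j, R.B x i j = pip (t * pd i R.X x) (pd j R.X x) • η := by
  have hp := R.paramM.mem hx
  have hY := R.isQuadricChart D.dim hN
  obtain ⟨η, hη⟩ := hY.exists_fderiv_eq (R.mapsTo hx) (w := t * R.X x + c)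
    (by rw [← R.comp_eq x hx, D.normal _ hp])
  refine ⟨η, ⟨?_, fun i => ?_⟩, fun i j => D.eq_of_fderiv_eq hN hx ?_⟩
  · rw [metricInner_eq, hη, D.unit_normal _ hp]
  · rw [metricInner_eq, hη, LocalRep.fderiv_pd_φ hx, pip_comm,
      D.pip_pd_normal R.paramM hx]
  · rw [D.fderiv_secondFundForm hN hx, map_smul, hη]

theorem normSqB_eq : R.normSqB x = -a := by
  simp only [LocalRep.normSqB, metricInner_eq, D.fderiv_secondFundForm hN hx,
    pip_smul_left, pip_smul_right, D.unit_normal _ (R.paramM.mem hx)]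
  rw [← D.trace_shape_sq R.paramM hx, ← Finset.sum_neg_distrib]
  refine Finset.sum_congr rfl fun i _ => ?_
  rw [Finset.sum_comm, ← Finset.sum_neg_distrib]
  refine Finset.sum_congr rfl fun b _ => ?_
  conv_rhs => rw [pip_comm, ← D.sum_inv_mul_pip_mul_pd R.paramM hx i]
  simp only [pip_sum_right, pip_smul_right, Finset.mul_sum, ← Finset.sum_neg_distrib]
  exact Finset.sum_congr rfl fun j _ => Finset.sum_congr rfl fun l _ => by
    rw [LocalRep.g]; ring

theorem metricInner_meanCurvature :
    metricInner R.h (R.φ x) (R.meanCurvature x) (R.meanCurvature x) = -(1 / k * f) ^ 2 := by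
  rw [metricInner_eq, LocalRep.meanCurvature, map_smul, D.fderiv_tension hN hx,
    smul_smul, pip_smul_left, pip_smul_right, D.unit_normal _ (R.paramM.mem hx)]
  ring

omit hN in
theorem normal_ne_zero : t * R.X x + c ≠ 0 := by
  intro h
  have := D.unit_normal _ (R.paramM.mem hx)
  rw [h, pip_zero_left] at this
  norm_num at this

theorem tension_eq_zero_iff : tension R.g R.h R.φ x = 0 ↔ f = 0 := by
  rw [← smul_eq_zero_iff_left (r := f) (D.normal_ne_zero hx), ← D.fderiv_tension hN hx]
  refine ⟨fun h => by rw [h, map_zero], fun h => D.eq_of_fderiv_eq hN hx (by rw [h, map_zero])⟩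

theorem bitension_eq_zero_iff : bitension R.g R.h R.φ x = 0 ↔ f * (a - k) = 0 := by
  rw [← smul_eq_zero_iff_left (r := f * (a - k)) (D.normal_ne_zero hx), ← D.fderiv_bitension hN hx]
  refine ⟨fun h => by rw [h, map_zero], fun h => D.eq_of_fderiv_eq hN hx (by rw [h, map_zero])⟩

omit hx in
theorem hasConstantMeanCurvature : HasConstantMeanCurvature k (k + 1) M N :=
  ⟨_, fun _ _ hx => D.metricInner_meanCurvature hN hx⟩

omit hx in
/-- Since `τ₂(φ) = f (a - k) η` and `τ(φ) = f η`, both conditions are conditions on constants; a local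
representation with non-empty domain is needed because the empty set is vacuously harmonic. -/
theorem isProperBiharmonic_iff (hR : ∃ R : LocalRep k (k + 1) M N, R.U.Nonempty) :
    IsProperBiharmonic k (k + 1) M N ↔ f ≠ 0 ∧ a = k := by
  obtain ⟨R, x, hx⟩ := hR
  have hharm : IsHarmonic k (k + 1) M N ↔ f = 0 :=
    ⟨fun h => (D.tension_eq_zero_iff hN hx).1 (h R x hx),
      fun h _ _ hz => (D.tension_eq_zero_iff hN hz).2 h⟩
  have hbiharm : IsBiharmonic k (k + 1) M N ↔ f * (a - k) = 0 :=
    ⟨fun h => (D.bitension_eq_zero_iff hN hx).1 (h R x hx),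
      fun h _ _ hz => (D.bitension_eq_zero_iff hN hz).2 h⟩
  rw [IsProperBiharmonic, hharm, hbiharm, mul_eq_zero, sub_eq_zero]
  tauto

end HasDiagonalNormal

/-! ### Graph parametrizations -/

section Graphs

variable {k q ν : ℕ}

/-- A map whose components include all the coordinates of its argument, and whose image is
relatively open, is a local parametrization. -/
theorem isLocalParam_of_coordinates {S : Set (PE q ν)} {U : Set (Co k)} {X : Co k → PE q ν}
    (idx : Fin k → Fin q ⊕ Fin ν) (hU : IsOpen U) (hX : ContDiffOn ℝ ∞ X U)
    (hidx : ∀ x ∈ U, ∀ l, X x (idx l) = x l)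
    {W : Set (PE q ν)} (hW : IsOpen W) (himage : X '' U = S ∩ W) : IsLocalParam S U X where
  isOpen := hU
  smooth := hX
  immersion x hx := by
    let ρ : PE q ν →L[ℝ] Co k := ContinuousLinearMap.pi fun l =>
      ContinuousLinearMap.proj (R := ℝ) (φ := fun _ : Fin q ⊕ Fin ν => ℝ) (idx l)
    have h1 : HasFDerivAt (fun z => ρ (X z)) (ρ.comp (fderiv ℝ X x)) x :=
      ρ.hasFDerivAt.comp x (hX.differentiableAt_of_isOpen hU hx).hasFDerivAt
    have h2 : HasFDerivAt (fun z => ρ (X z)) (ContinuousLinearMap.id ℝ (Co k)) x :=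
      (hasFDerivAt_id x).congr_of_eventuallyEq <|
        Filter.eventuallyEq_of_mem (hU.mem_nhds hx) fun z hz => funext fun l => hidx z hz l
    intro v w hvw
    have := congrArg ρ hvw
    have h3 := h1.unique h2
    calc v = ρ.comp (fderiv ℝ X x) v := by rw [h3]; rfl
      _ = ρ.comp (fderiv ℝ X x) w := this
      _ = w := by rw [h3]; rfl
  image_eq := ⟨W, hW, himage⟩
  inverse := ⟨fun p l => p (idx l), by fun_prop, fun x hx => funext fun l => hidx x hx l⟩

theorem mem_antiDeSitter {n : ℕ} {p : PE n 2} : p ∈ antiDeSitter n ↔ pip p p = -1 := by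
  change pip p p = -1 ^ 2 ↔ _
  norm_num

theorem pip_self_eq_two {n : ℕ} (p : PE n 2) : pip p p =
    ∑ i, p (Sum.inl i) ^ 2 - (p (Sum.inr 0) ^ 2 + p (Sum.inr 1) ^ 2) := by
  simp [pip, Fin.sum_univ_two, sq]

/-- The quantity `1 + |x|² - y²` for `z = (x, y)`: on anti-de Sitter space it is the square of the
time-like coordinate that is solved for. -/
def adsRadicand {n : ℕ} (z : Co (n + 1)) : ℝ :=
  1 + ∑ i : Fin n, z i.castSucc ^ 2 - z (Fin.last n) ^ 2

/-- The graph chart of anti-de Sitter space over all coordinates except the `j`-th time-like one,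
which has the sign `σ`. -/
noncomputable def adsChart {n : ℕ} (j : Fin 2) (σ : ℝ) (z : Co (n + 1)) : PE n 2 :=
  Sum.elim (fun i => z i.castSucc)
    (fun l => if l = j then σ * √(adsRadicand z) else z (Fin.last n))

theorem contDiff_adsRadicand {n : ℕ} : ContDiff ℝ ∞ (adsRadicand (n := n)) := by
  unfold adsRadicand
  fun_prop

theorem isOpen_adsRadicand_pos {n : ℕ} : IsOpen {z : Co (n + 1) | 0 < adsRadicand z} :=
  isOpen_lt continuous_const contDiff_adsRadicand.continuous

theorem pip_adsChart {n : ℕ} (j : Fin 2) {σ : ℝ} (hσ : σ ^ 2 = 1) {z : Co (n + 1)}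
    (hz : 0 < adsRadicand z) : pip (adsChart j σ z) (adsChart j σ z) = -1 := by
  have h := Real.sq_sqrt hz.le
  rw [pip_self_eq_two]
  fin_cases j <;> simp [adsChart, mul_pow, hσ, h] <;> simp [adsRadicand]

theorem adsChart_eq {n : ℕ} (j : Fin 2) {σ : ℝ} (hσ : σ ^ 2 = 1) {p : PE n 2}
    (hp : p ∈ antiDeSitter n) (hpos : 0 < σ * p (Sum.inr j)) {z : Co (n + 1)}
    (hz : ∀ i : Fin n, z i.castSucc = p (Sum.inl i)) (hl : z (Fin.last n) = p (Sum.inr (j + 1))) :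
    0 < adsRadicand z ∧ adsChart j σ z = p := by
  have hrad : adsRadicand z = (σ * p (Sum.inr j)) ^ 2 := by
    rw [mem_antiDeSitter, pip_self_eq_two] at hp
    rw [mul_pow, hσ, adsRadicand, hl]
    simp only [hz]
    fin_cases j <;> simp <;> linarith
  refine ⟨by rw [hrad]; positivity, ?_⟩
  funext α
  rcases α with i | l
  · exact hz i
  · by_cases hlj : l = j
    · subst hlj
      simp only [adsChart, Sum.elim_inr, if_true, hrad, Real.sqrt_sq hpos.le]
      rw [← mul_assoc, ← sq, hσ, one_mul]
    · have : l = j + 1 := by omega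
      simp [adsChart, this, hl]

theorem isLocalParam_adsChart {n : ℕ} (j : Fin 2) {σ : ℝ} (hσ : σ ^ 2 = 1) :
    IsLocalParam (antiDeSitter n) {z | 0 < adsRadicand z} (adsChart j σ) := by
  have hσ0 : σ ≠ 0 := by rintro rfl; norm_num at hσ
  refine isLocalParam_of_coordinates (Fin.lastCases (Sum.inr (j + 1)) Sum.inl)
    isOpen_adsRadicand_pos ?_ ?_ (W := {p | 0 < σ * p (Sum.inr j)}) ?_ ?_
  · refine contDiffOn_pi.2 fun α => ?_
    rcases α with i | l
    · exact (contDiff_apply ℝ ℝ (n := ∞) i.castSucc).contDiffOn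
    · by_cases hlj : l = j
      · simp only [adsChart, Sum.elim_inr, hlj, if_true]
        exact contDiffOn_const.mul
          (contDiff_adsRadicand.contDiffOn.sqrt fun z hz => ne_of_gt hz)
      · simp only [adsChart, Sum.elim_inr, hlj, if_false]
        exact (contDiff_apply ℝ ℝ (n := ∞) (Fin.last n)).contDiffOn
  · intro z _ l
    refine Fin.lastCases ?_ (fun i => ?_) l
    · simp [adsChart]
    · simp [adsChart]
  · exact isOpen_lt continuous_const (by fun_prop)
  · ext p
    constructor
    · rintro ⟨z, hz, rfl⟩
      refine ⟨mem_antiDeSitter.2 (pip_adsChart j hσ hz), ?_⟩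
      have : 0 < √(adsRadicand z) := Real.sqrt_pos.2 hz
      simp only [adsChart, Set.mem_ofPred_eq, Sum.elim_inr, if_true]
      rw [← mul_assoc, ← sq, hσ, one_mul]
      exact this
    · rintro ⟨hp, hpos⟩
      obtain ⟨h1, h2⟩ := adsChart_eq j hσ hp hpos
        (z := Fin.snoc (fun i => p (Sum.inl i)) (p (Sum.inr (j + 1)))) (by simp) (by simp)
      exact ⟨_, h1, h2⟩

theorem isSubmanifold_antiDeSitter (n : ℕ) : IsSubmanifold (n + 1) (antiDeSitter n) := by
  intro p hp
  -- the two time-like coordinates do not vanish simultaneously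
  obtain ⟨j, hj⟩ : ∃ j, p (Sum.inr j) ≠ 0 := by
    by_contra! h
    rw [mem_antiDeSitter, pip_self_eq_two, h 0, h 1] at hp
    have : 0 ≤ ∑ i, p (Sum.inl i) ^ 2 := Finset.sum_nonneg fun i _ => sq_nonneg _
    linarith
  obtain ⟨σ, hσ, hpos⟩ : ∃ σ : ℝ, σ ^ 2 = 1 ∧ 0 < σ * p (Sum.inr j) := by
    rcases lt_or_gt_of_ne hj with h | h
    · exact ⟨-1, by norm_num, by linarith⟩
    · exact ⟨1, by norm_num, by linarith⟩
  obtain ⟨h1, h2⟩ := adsChart_eq j hσ hp hpos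
    (z := Fin.snoc (fun i => p (Sum.inl i)) (p (Sum.inr (j + 1)))) (by simp) (by simp)
  exact ⟨_, _, isLocalParam_adsChart j hσ, _, h1, h2⟩

/-- `M` is the graph over the space-like coordinates of a function `F` with values in the two
time-like coordinates, contained in the part of anti-de Sitter space where the first time-like
coordinate is positive. -/
structure IsAdSGraph {n : ℕ} (M : Set (PE n 2)) (F : Co n → Fin 2 → ℝ) : Prop where
  smooth : ContDiff ℝ ∞ F
  range_eq : Set.range (fun z => (Sum.elim z (F z) : PE n 2)) = M
  pos : ∀ z, 0 < F z 0
  sq_add_sq : ∀ z, F z 0 ^ 2 + F z 1 ^ 2 = 1 + ∑ i, z i ^ 2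

namespace IsAdSGraph

variable {n : ℕ} {M : Set (PE n 2)} {F : Co n → Fin 2 → ℝ}

theorem subset (h : IsAdSGraph M F) : M ⊆ antiDeSitter n := by
  rw [← h.range_eq]
  rintro _ ⟨z, rfl⟩
  rw [mem_antiDeSitter, pip_self_eq_two]
  have := h.sq_add_sq z
  simp only [Sum.elim_inl, Sum.elim_inr]
  linarith

theorem isLocalParam (h : IsAdSGraph M F) :
    IsLocalParam M Set.univ fun z => (Sum.elim z (F z) : PE n 2) := by
  refine isLocalParam_of_coordinates Sum.inl isOpen_univ ?_ (fun _ _ _ => rfl) isOpen_univ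
    (by rw [Set.image_univ, h.range_eq, Set.inter_univ])
  refine contDiffOn_pi.2 fun α => ?_
  rcases α with i | l
  · exact (contDiff_apply ℝ ℝ (n := ∞) i).contDiffOn
  · exact ((contDiff_pi.1 h.smooth) l).contDiffOn

theorem isSubmanifold (h : IsAdSGraph M F) : IsSubmanifold n M := by
  intro p hp
  rw [← h.range_eq] at hp
  obtain ⟨z, rfl⟩ := hp
  exact ⟨_, _, h.isLocalParam, z, Set.mem_univ z, rfl⟩

/-- A global representation of the inclusion, in the chart of anti-de Sitter space that solves for
the first time-like coordinate. -/
theorem exists_localRep (h : IsAdSGraph M F) :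
    ∃ R : LocalRep n (n + 1) M (antiDeSitter n), R.U.Nonempty := by
  have key : ∀ z, 0 < adsRadicand (Fin.snoc z (F z 1) : Co (n + 1)) ∧
      adsChart 0 1 (Fin.snoc z (F z 1) : Co (n + 1)) = Sum.elim z (F z) := fun z =>
    adsChart_eq 0 (by norm_num)
      (h.subset (h.range_eq ▸ Set.mem_range_self z : Sum.elim z (F z) ∈ M))
      (by simpa using h.pos z) (by simp) (by simp)
  refine ⟨{ U := Set.univ
            X := fun z => Sum.elim z (F z)
            V := {z | 0 < adsRadicand z}
            Y := adsChart 0 1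
            φ := fun z => (Fin.snoc z (F z 1) : Co (n + 1))
            paramM := h.isLocalParam
            paramN := isLocalParam_adsChart 0 (by norm_num)
            smooth := ?_
            mapsTo := fun z _ => (key z).1
            comp_eq := fun z _ => (key z).2.symm }, 0, Set.mem_univ _⟩
  refine contDiffOn_pi.2 fun l => ?_
  refine Fin.lastCases ?_ (fun i => ?_) l
  · simpa using (contDiff_pi.1 h.smooth 1).contDiffOn
  · simpa using (contDiff_apply ℝ ℝ (n := ∞) i).contDiffOn

end IsAdSGraph

end Graphs

/-! ### Space-like hypersurfaces -/

/-- The signature `(n, 2)` leaves no room for a third non-space-like direction: a vector orthogonal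
to two orthogonal time-like unit vectors is space-like. -/
theorem pip_self_pos_of_orthogonal {n : ℕ} {p η w : PE n 2} (hp : pip p p = -1)
    (hη : pip η η = -1) (hηp : pip η p = 0) (hwp : pip w p = 0) (hwη : pip w η = 0)
    (hw : w ≠ 0) : 0 < pip w w := by
  by_contra! hle
  -- some combination of the three vectors has vanishing time-like part
  let v : Fin 3 → Fin 2 → ℝ :=
    ![fun l => p (Sum.inr l), fun l => η (Sum.inr l), fun l => w (Sum.inr l)]
  have hdep : ¬ LinearIndependent ℝ v := fun hli => by
    have := hli.fintype_card_le_finrank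
    simp at this
  obtain ⟨g, hg, i, hi⟩ := Fintype.not_linearIndependent_iff.1 hdep
  set z : PE n 2 := g 0 • p + g 1 • η + g 2 • w with hz
  have hzr : ∀ l, z (Sum.inr l) = 0 := by
    intro l
    have := congrFun hg l
    simpa [Fin.sum_univ_three, v, hz] using this
  have h1 : pip z z = ∑ i, z (Sum.inl i) ^ 2 := by
    rw [pip_self_eq_two, hzr, hzr]
    ring
  have h2 : pip z z = -(g 0) ^ 2 - g 1 ^ 2 + g 2 ^ 2 * pip w w := by
    simp only [hz, pip_add_left, pip_add_right, pip_smul_left, pip_smul_right, hp, hη, hηp, hwp,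
      hwη, pip_comm p η, pip_comm p w, pip_comm η w]
    ring
  have h3 : 0 ≤ ∑ i, z (Sum.inl i) ^ 2 := Finset.sum_nonneg fun i _ => sq_nonneg _
  have h4 : g 2 ^ 2 * pip w w ≤ 0 := mul_nonpos_of_nonneg_of_nonpos (sq_nonneg _) hle
  have h5 : g 0 = 0 := by nlinarith [sq_nonneg (g 0), sq_nonneg (g 1)]
  have h6 : g 1 = 0 := by nlinarith [sq_nonneg (g 0), sq_nonneg (g 1)]
  have hz0 : z = 0 := by
    have h7 : ∑ i, z (Sum.inl i) ^ 2 = 0 := by nlinarith [sq_nonneg (g 0), sq_nonneg (g 1)]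
    rw [Finset.sum_eq_zero_iff_of_nonneg fun i _ => sq_nonneg _] at h7
    funext α
    rcases α with i | l
    · simpa using h7 i (Finset.mem_univ i)
    · exact hzr l
  have h8 : g 2 = 0 := by
    rw [hz, h5, h6, zero_smul, zero_smul, zero_add, zero_add] at hz0
    exact (smul_eq_zero.1 hz0).resolve_right hw
  fin_cases i
  · exact hi h5
  · exact hi h6
  · exact hi h8

theorem HasDiagonalNormal.posDef_inducedMetric {n : ℕ} {M : Set (PE n 2)} {t c : PE n 2} {f a : ℝ}
    (D : HasDiagonalNormal n M t c f a) {U : Set (Co n)} {X : Co n → PE n 2}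
    (hX : IsLocalParam M U X) {x : Co n} (hx : x ∈ U) : (inducedMetric X x).PosDef := by
  refine Matrix.posDef_iff_dotProduct_mulVec.2 ⟨?_, fun v hv => ?_⟩
  · ext i j
    exact inducedMetric_comm X x j i
  · have h : pip (fderiv ℝ X x v) (fderiv ℝ X x v) =
        star v ⬝ᵥ (inducedMetric X x).mulVec v := by
      rw [← metricInner_inducedMetric, metricInner]
      simp only [dotProduct, Matrix.mulVec, Finset.mul_sum, star_trivial]
      exact Finset.sum_congr rfl fun i _ => Finset.sum_congr rfl fun j _ => by ring
    rw [← h]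
    have hp := hX.mem hx
    refine pip_self_pos_of_orthogonal (D.unit _ hp) (D.unit_normal _ hp) (D.normal _ hp) ?_ ?_
      fun h0 => hv (hX.immersion x hx (h0.trans (map_zero _).symm))
    · simp [fderiv_eq_sum_pd, pip_sum_left, pip_smul_left, D.pip_pd_self hX hx]
    · simp [fderiv_eq_sum_pd, pip_sum_left, pip_smul_left, D.pip_pd_normal hX hx]

theorem HasDiagonalNormal.isSpacelikeHypersurface {n : ℕ} {M : Set (PE n 2)} {t c : PE n 2}
    {f a : ℝ} (D : HasDiagonalNormal n M t c f a) {F : Co n → Fin 2 → ℝ} (h : IsAdSGraph M F) :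
    IsSpacelikeHypersurface n M (antiDeSitter n) where
  subset := h.subset
  submanifold := h.isSubmanifold
  ambient := isSubmanifold_antiDeSitter n
  nondegenerate V Y hY y hy := by
    have hY' : IsQuadricChart V Y := ⟨rfl, hY.isOpen, hY.smooth, hY.immersion,
      fun z hz => mem_antiDeSitter.1 (hY.mem hz)⟩
    exact hY'.det_ne_zero hy
  spacelike U X hX x hx := D.posDef_inducedMetric hX hx

/-! ### Hyperbolic spaces as graphs -/

theorem mem_hyperbolic_iff {n : ℕ} {r : ℝ} {z : PE n 1} :
    z ∈ hyperbolic n r ↔ pip z z = -r ^ 2 ∧ 0 < z (Sum.inr 0) := Iff.rfl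

theorem pip_self_eq_one {n : ℕ} (z : PE n 1) :
    pip z z = ∑ i, z (Sum.inl i) ^ 2 - z (Sum.inr 0) ^ 2 := by
  simp [pip, sq]

/-- The time-like coordinate of the point of `H^n(r)` above `x`. -/
noncomputable def hyperbolicHeight {n : ℕ} (r : ℝ) (x : Co n) : ℝ := √(r ^ 2 + ∑ i, x i ^ 2)

section Height

variable {n : ℕ} {r : ℝ}

theorem hyperbolicHeight_radicand_pos (hr : 0 < r) (x : Co n) : 0 < r ^ 2 + ∑ i, x i ^ 2 :=
  add_pos_of_pos_of_nonneg (by positivity) (Finset.sum_nonneg fun i _ => sq_nonneg _)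

theorem hyperbolicHeight_sq (hr : 0 < r) (x : Co n) :
    hyperbolicHeight r x ^ 2 = r ^ 2 + ∑ i, x i ^ 2 :=
  Real.sq_sqrt (hyperbolicHeight_radicand_pos hr x).le

theorem hyperbolicHeight_pos (hr : 0 < r) (x : Co n) : 0 < hyperbolicHeight r x :=
  Real.sqrt_pos.2 (hyperbolicHeight_radicand_pos hr x)

theorem contDiff_hyperbolicHeight (hr : 0 < r) :
    ContDiff ℝ ∞ (hyperbolicHeight (n := n) r) :=
  ContDiff.sqrt (by fun_prop) fun x => (hyperbolicHeight_radicand_pos hr x).ne'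

theorem mem_hyperbolic_iff_height (hr : 0 < r) {z : PE n 1} :
    z ∈ hyperbolic n r ↔ z (Sum.inr 0) = hyperbolicHeight r fun i => z (Sum.inl i) := by
  rw [mem_hyperbolic_iff, pip_self_eq_one]
  constructor
  · rintro ⟨h1, h2⟩
    rw [hyperbolicHeight, ← Real.sqrt_sq h2.le]
    congr 1
    linarith
  · intro h
    rw [h, hyperbolicHeight_sq hr]
    exact ⟨by ring, hyperbolicHeight_pos hr _⟩

end Height

/-! ### The slices of anti-de Sitter space -/

section Slice

variable {n : ℕ}

theorem pip_slicePoint (z w : PE n 1) (a b : ℝ) :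
    pip (slicePoint z a) (slicePoint w b) = pip z w - a * b := by
  simp [pip, slicePoint, Fin.sum_univ_two]
  ring

theorem slicePoint_mul (z w : PE n 1) (a b : ℝ) :
    slicePoint z a * slicePoint w b = slicePoint (z * w) (a * b) := by
  funext α
  rcases α with i | l
  · rfl
  · fin_cases l <;> rfl

theorem slicePoint_add (z w : PE n 1) (a b : ℝ) :
    slicePoint z a + slicePoint w b = slicePoint (z + w) (a + b) := by
  funext α
  rcases α with i | l
  · rfl
  · fin_cases l <;> rfl

theorem const_mul_eq_smul {q ν : ℕ} (a : ℝ) (z : PE q ν) : (fun _ => a) * z = a • z := rfl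

theorem hyperbolicSlice_eq {s : ℝ} (hs : |s| < 1) :
    hyperbolicSlice n √(1 - s ^ 2) s =
      {x | x ∈ antiDeSitter n ∧ x (Sum.inr 1) = s ∧ 0 < x (Sum.inr 0)} := by
  have hs2 : 0 ≤ 1 - s ^ 2 := by nlinarith [abs_lt.1 hs, sq_abs s, abs_nonneg s]
  ext x
  constructor
  · rintro ⟨z, hz, rfl⟩
    rw [mem_hyperbolic_iff, Real.sq_sqrt hs2] at hz
    refine ⟨?_, rfl, hz.2⟩
    rw [mem_antiDeSitter, pip_slicePoint, hz.1]
    ring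
  · rintro ⟨h1, h2, h3⟩
    have hx : slicePoint (Sum.elim (fun i => x (Sum.inl i)) fun _ => x (Sum.inr 0)) s = x := by
      funext α
      rcases α with i | l
      · rfl
      · fin_cases l
        · rfl
        · exact h2.symm
    refine ⟨_, ?_, hx⟩
    rw [mem_hyperbolic_iff, Real.sq_sqrt hs2]
    refine ⟨?_, h3⟩
    rw [mem_antiDeSitter, ← hx, pip_slicePoint] at h1
    linarith

variable {r s : ℝ}

theorem isAdSGraph_hyperbolicSlice (hr : 0 < r) (hrs : r ^ 2 + s ^ 2 = 1) :
    IsAdSGraph (hyperbolicSlice n r s) fun x => ![hyperbolicHeight r x, s] where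
  smooth := by
    refine contDiff_pi.2 fun l => ?_
    fin_cases l
    · exact contDiff_hyperbolicHeight hr
    · exact contDiff_const
  range_eq := by
    ext p
    constructor
    · rintro ⟨z, rfl⟩
      exact ⟨Sum.elim z fun _ => hyperbolicHeight r z, (mem_hyperbolic_iff_height hr).2 rfl, rfl⟩
    · rintro ⟨z, hz, rfl⟩
      refine ⟨fun i => z (Sum.inl i), ?_⟩
      simp only [slicePoint, (mem_hyperbolic_iff_height hr).1 hz]
  pos := hyperbolicHeight_pos hr
  sq_add_sq z := by
    simp only [Matrix.cons_val_zero, Matrix.cons_val_one, hyperbolicHeight_sq hr]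
    linarith

/-- At `(z, s)` the unit normal is `((s/r) z, -r)`, so the shape operator is `s/r`. -/
theorem hasDiagonalNormal_hyperbolicSlice (hr : 0 < r) (hrs : r ^ 2 + s ^ 2 = 1) :
    HasDiagonalNormal n (hyperbolicSlice n r s) (slicePoint (fun _ => s / r) 0)
      (slicePoint 0 (-r)) (n * (s / r)) (n * (s / r) ^ 2) := by
  have hr0 := hr.ne'
  have hs2 : s ^ 2 = 1 - r ^ 2 := by linarith
  have hη : ∀ z : PE n 1, slicePoint (fun _ => s / r) 0 * slicePoint z s + slicePoint 0 (-r) =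
      slicePoint ((s / r) • z) (-r) := fun z => by
    rw [slicePoint_mul, slicePoint_add, const_mul_eq_smul, add_zero, zero_mul, zero_add]
  have hsum : ∀ a : ℝ, ∑ i, slicePoint (n := n) (fun _ => a) 0 i = (n + 1) * a := fun a => by
    simp [slicePoint, Fintype.sum_sum_type, add_mul]
  refine ⟨rfl, ?_, ?_, ?_, ⟨r * s, ?_⟩, ?_, ?_, ?_⟩ <;> rintro _ ⟨z, hz, rfl⟩ <;>
    have hz' := (mem_hyperbolic_iff.1 hz).1 <;> beta_reduce
  · rw [pip_slicePoint, hz']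
    linarith
  · rw [hη, pip_slicePoint, pip_smul_left, hz']
    field_simp
    ring
  · rw [hη, pip_slicePoint, pip_smul_left, pip_smul_right, hz']
    field_simp
    rw [hs2]
    ring
  · rw [pip_slicePoint, pip_zero_left]
    ring
  · rw [hη, hsum, slicePoint_mul, slicePoint_mul, pip_slicePoint, pip_slicePoint,
      const_mul_eq_smul, const_mul_eq_smul]
    simp only [pip_smul_left, pip_smul_right, hz']
    field_simp
    linear_combination (-s) * hrs
  · have hconst : (fun _ => s / r : PE n 1) * (fun _ => s / r) = fun _ => (s / r) ^ 2 :=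
      funext fun _ => (sq _).symm
    rw [hη, slicePoint_mul, mul_zero, hconst, hsum, slicePoint_mul, slicePoint_mul,
      pip_slicePoint, pip_slicePoint, const_mul_eq_smul, const_mul_eq_smul]
    simp only [pip_smul_left, pip_smul_right, hz']
    field_simp
    linear_combination (-s ^ 2) * hrs
  · rw [hη, slicePoint_mul, slicePoint_mul]
    funext α
    rcases α with i | l
    · simp only [slicePoint, Pi.sub_apply, Pi.add_apply, Pi.smul_apply, Pi.mul_apply, smul_eq_mul,
        Sum.elim_inl]
      field_simp
      ring
    · fin_cases l
      · simp [slicePoint]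
        field_simp
        ring
      · simp [slicePoint]
        field_simp

/-- Multiplication by `t` acts on tangent vectors of the slice as the scalar `s/r`. -/
theorem pip_mul_pd_hyperbolicSlice (hr : 0 < r) (hrs : r ^ 2 + s ^ 2 = 1) {U : Set (Co n)}
    {X : Co n → PE n 2} (hX : IsLocalParam (hyperbolicSlice n r s) U X) {x : Co n} (hx : x ∈ U)
    (i j : Fin n) : pip (slicePoint (fun _ => s / r) 0 * pd i X x) (pd j X x) =
      s / r * inducedMetric X x i j := by
  have h0 : pd i X x (Sum.inr 1) = 0 := by
    have := (hasDiagonalNormal_hyperbolicSlice hr hrs).pip_pd_const hX hx i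
    simpa [pip, slicePoint, Fin.sum_univ_two, hr.ne'] using this
  have h1 : slicePoint (fun _ => s / r) 0 * pd i X x = (s / r) • pd i X x := by
    funext α
    rcases α with i | l
    · rfl
    · fin_cases l
      · rfl
      · simp [slicePoint, h0]
  rw [h1, pip_smul_left, inducedMetric_apply]

end Slice

/-! ### Products of hyperbolic spaces -/

section CliffordTorus

variable {m n : ℕ}

theorem pairPoint_mul (u u' : PE m 1) (v v' : PE n 1) :
    pairPoint u v * pairPoint u' v' = pairPoint (u * u') (v * v') := by
  funext α
  rcases α with i | l
  · refine Fin.addCases (fun i => ?_) (fun i => ?_) i <;> simp [pairPoint]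
  · fin_cases l <;> rfl

theorem pairPoint_fstPart_sndPart (x : PE (m + n) 2) :
    pairPoint (fstPart x) (sndPart x) = x := by
  funext α
  rcases α with i | l
  · refine Fin.addCases (fun i => ?_) (fun i => ?_) i <;> simp [pairPoint, fstPart, sndPart]
  · fin_cases l <;> rfl

theorem sum_pairPoint (u : PE m 1) (v : PE n 1) :
    ∑ α, pairPoint u v α = ∑ α, u α + ∑ α, v α := by
  simp [pairPoint, Fintype.sum_sum_type, Fin.sum_univ_add, Fin.sum_univ_two]
  ring

theorem pairPoint_const_apply (a b : ℝ) (α : Fin (m + n) ⊕ Fin 2) :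
    pairPoint (m := m) (n := n) (fun _ => a) (fun _ => b) α = a ∨
      pairPoint (m := m) (n := n) (fun _ => a) (fun _ => b) α = b := by
  rcases α with i | l
  · refine Fin.addCases (fun i => ?_) (fun i => ?_) i <;> simp [pairPoint]
  · fin_cases l <;> simp [pairPoint]

variable {r s : ℝ}

theorem isAdSGraph_cliffordTorus (hr : 0 < r) (hs : 0 < s) (hrs : r ^ 2 + s ^ 2 = 1) :
    IsAdSGraph (cliffordTorus m n r s) fun x =>
      ![hyperbolicHeight r fun i => x (Fin.castAdd n i),
        hyperbolicHeight s fun j => x (Fin.natAdd m j)] where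
  smooth := by
    refine contDiff_pi.2 fun l => ?_
    fin_cases l
    · exact (contDiff_hyperbolicHeight hr).comp (contDiff_pi.2 fun i => contDiff_apply ℝ ℝ _)
    · exact (contDiff_hyperbolicHeight hs).comp (contDiff_pi.2 fun i => contDiff_apply ℝ ℝ _)
  range_eq := by
    ext p
    constructor
    · rintro ⟨z, rfl⟩
      refine ⟨_, (mem_hyperbolic_iff_height hr).2 ?_, _, (mem_hyperbolic_iff_height hs).2 ?_,
        (pairPoint_fstPart_sndPart _).symm⟩ <;> rfl
    · rintro ⟨u, hu, v, hv, rfl⟩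
      refine ⟨fun i => pairPoint u v (Sum.inl i), ?_⟩
      funext α
      rcases α with i | l
      · rfl
      · fin_cases l
        · simp [pairPoint, (mem_hyperbolic_iff_height hr).1 hu]
        · simp [pairPoint, (mem_hyperbolic_iff_height hs).1 hv]
  pos z := hyperbolicHeight_pos hr _
  sq_add_sq z := by
    simp only [Matrix.cons_val_zero, Matrix.cons_val_one, hyperbolicHeight_sq hr,
      hyperbolicHeight_sq hs, Fin.sum_univ_add]
    linarith

/-- At `(u, v)` the unit normal is `((s/r) u, -(r/s) v)`, so the shape operator is `s/r` on the
first factor and `-r/s` on the second one. -/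
theorem hasDiagonalNormal_cliffordTorus (hr : 0 < r) (hs : 0 < s) (hrs : r ^ 2 + s ^ 2 = 1) :
    HasDiagonalNormal (m + n) (cliffordTorus m n r s)
      (pairPoint (fun _ => s / r) (fun _ => -(r / s))) 0
      (m * (s / r) - n * (r / s)) (s ^ 2 / r ^ 2 * m + r ^ 2 / s ^ 2 * n) := by
  have hr0 := hr.ne'
  have hs0 := hs.ne'
  have hs2 : s ^ 2 = 1 - r ^ 2 := by linarith
  have hη : ∀ (a b : ℝ) (u : PE m 1) (v : PE n 1),
      pairPoint (fun _ => a) (fun _ => b) * pairPoint u v = pairPoint (a • u) (b • v) :=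
    fun a b u v => by rw [pairPoint_mul, const_mul_eq_smul, const_mul_eq_smul]
  have hsum : ∀ a b : ℝ, ∑ i, pairPoint (m := m) (n := n) (fun _ => a) (fun _ => b) i =
      (m + 1) * a + (n + 1) * b := fun a b => by
    rw [sum_pairPoint]
    simp [add_mul]
  refine ⟨rfl, ?_, ?_, ?_, ⟨0, fun p _ => pip_zero_left p⟩, ?_, ?_, ?_⟩ <;>
    rintro _ ⟨u, hu, v, hv, rfl⟩ <;> have hu' := (mem_hyperbolic_iff.1 hu).1 <;>
    have hv' := (mem_hyperbolic_iff.1 hv).1 <;> try rw [add_zero]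
  · rw [pip_pairPoint, hu', hv']
    linarith
  · rw [hη, pip_pairPoint, pip_smul_left, pip_smul_left, hu', hv']
    field_simp
    ring
  · rw [hη, pip_pairPoint]
    simp only [pip_smul_left, pip_smul_right, hu', hv']
    field_simp
    linarith
  · rw [hη, hη, hsum, pip_pairPoint, pip_pairPoint]
    simp only [pip_smul_left, pip_smul_right, hu', hv']
    field_simp
    rw [show s ^ 4 = (s ^ 2) ^ 2 by ring, hs2]
    ring
  · have hconst : pairPoint (m := m) (n := n) (fun _ => s / r) (fun _ => -(r / s)) *
        pairPoint (fun _ => s / r) (fun _ => -(r / s)) =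
        pairPoint (fun _ => (s / r) ^ 2) (fun _ => (r / s) ^ 2) := by
      rw [pairPoint_mul]
      congr 1 <;> funext _ <;> simp only [Pi.mul_apply] <;> ring
    rw [hconst, hη, hη, hη, hsum, pip_pairPoint, pip_pairPoint]
    simp only [pip_smul_left, pip_smul_right, hu', hv']
    field_simp
    linear_combination (-(s ^ 4 + r ^ 4)) * hrs
  · funext α
    simp only [Pi.sub_apply, Pi.add_apply, Pi.smul_apply, Pi.mul_apply, smul_eq_mul]
    rcases pairPoint_const_apply (m := m) (n := n) (s / r) (-(r / s)) α with h | h <;> rw [h] <;>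
      push_cast <;> field_simp <;> ring

theorem pip_mul_cliffordTorus (a b : ℝ) (x y : PE (m + n) 2) :
    pip (pairPoint (fun _ => a) (fun _ => b) * x) y =
      a * pip (fstPart (m := m) (n := n) x) (fstPart (m := m) (n := n) y)
        + b * pip (sndPart (m := m) (n := n) x) (sndPart (m := m) (n := n) y) := by
  conv_lhs => rw [← pairPoint_fstPart_sndPart x, ← pairPoint_fstPart_sndPart y]
  rw [pairPoint_mul, pip_pairPoint, const_mul_eq_smul, const_mul_eq_smul, pip_smul_left,
    pip_smul_left]

theorem isProperBiharmonic_cliffordTorus_iff (hr : 0 < r) (hs : 0 < s)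
    (hrs : r ^ 2 + s ^ 2 = 1) :
    IsProperBiharmonic (m + n) (m + n + 1) (cliffordTorus m n r s) (antiDeSitter (m + n)) ↔
      m ≠ n ∧ r = s := by
  rw [(hasDiagonalNormal_cliffordTorus hr hs hrs).isProperBiharmonic_iff
    (fun _ => mem_antiDeSitter.1) (isAdSGraph_cliffordTorus hr hs hrs).exists_localRep]
  have hr0 := hr.ne'
  have hs0 := hs.ne'
  have hf : (m * (s / r) - n * (r / s) : ℝ) * (r * s) = m * s ^ 2 - n * r ^ 2 := by
    field_simp
  -- `|A|² - (m + n) = (s² - r²) (m s² - n r²) / (r s)²`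
  have ha : (s ^ 2 / r ^ 2 * m + r ^ 2 / s ^ 2 * n - (m + n : ℕ) : ℝ) * (r * s) ^ 2 =
      (s ^ 2 - r ^ 2) * (m * s ^ 2 - n * r ^ 2) := by
    push_cast
    field_simp
    ring
  constructor
  · rintro ⟨h1, h2⟩
    have h3 : (m * s ^ 2 - n * r ^ 2 : ℝ) ≠ 0 := hf ▸ mul_ne_zero h1 (mul_ne_zero hr0 hs0)
    rw [h2, sub_self, zero_mul, eq_comm, mul_eq_zero] at ha
    have hrs' : r = s := by
      have : s ^ 2 = r ^ 2 := sub_eq_zero.1 (ha.resolve_right h3)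
      exact ((pow_left_inj₀ hs.le hr.le two_ne_zero).1 this).symm
    refine ⟨?_, hrs'⟩
    rintro rfl
    exact h3 (by rw [hrs']; ring)
  · rintro ⟨hmn, rfl⟩
    have hmn' : (m : ℝ) - n ≠ 0 := sub_ne_zero.2 (by exact_mod_cast hmn)
    constructor
    · intro h
      rw [h, zero_mul, eq_comm, ← sub_mul] at hf
      exact (mul_ne_zero hmn' (pow_ne_zero 2 hr0)) hf
    · rw [sub_self, zero_mul] at ha
      exact sub_eq_zero.1 ((mul_eq_zero.1 ha).resolve_right (by positivity))

end CliffordTorus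

theorem isProperBiharmonic_hyperbolicSlice_iff {n : ℕ} (hn : 1 ≤ n) {r s : ℝ} (hr : 0 < r)
    (hrs : r ^ 2 + s ^ 2 = 1) :
    IsProperBiharmonic n (n + 1) (hyperbolicSlice n r s) (antiDeSitter n) ↔ s ^ 2 = 1 / 2 := by
  rw [(hasDiagonalNormal_hyperbolicSlice hr hrs).isProperBiharmonic_iff
    (fun _ => mem_antiDeSitter.1) (isAdSGraph_hyperbolicSlice hr hrs).exists_localRep]
  have hr0 := hr.ne'
  have hn0 : (n : ℝ) ≠ 0 := by exact_mod_cast (by omega : n ≠ 0)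
  have h1 : (n * (s / r) ^ 2 : ℝ) = n ↔ s ^ 2 = 1 / 2 := by
    rw [mul_eq_left₀ hn0, div_pow, div_eq_one_iff_eq (pow_ne_zero 2 hr0)]
    constructor <;> intro h <;> linarith
  rw [h1, and_iff_right_iff_imp]
  intro h
  have : s ≠ 0 := by rintro rfl; norm_num at h
  positivity

end BiharmonicADS

theorem mainTheorem3 :
    -- the slice `H^n(1/√2)` of `H^{n+1}_1(1)`
    (∀ n : ℕ, 1 ≤ n →
      BiharmonicADS.IsSpacelikeHypersurface n
        (BiharmonicADS.hyperbolicSlice n (1 / √2) (1 / √2)) (BiharmonicADS.antiDeSitter n) ∧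
      BiharmonicADS.IsProperBiharmonic n (n + 1)
        (BiharmonicADS.hyperbolicSlice n (1 / √2) (1 / √2)) (BiharmonicADS.antiDeSitter n)) ∧
    -- the slices `x_{n+2} = s`
    (∀ n : ℕ, 1 ≤ n → ∀ s : ℝ, |s| < 1 →
      BiharmonicADS.hyperbolicSlice n √(1 - s ^ 2) s =
        {x | x ∈ BiharmonicADS.antiDeSitter n ∧ x (Sum.inr 1) = s ∧ 0 < x (Sum.inr 0)} ∧
      BiharmonicADS.IsSpacelikeHypersurface n
        (BiharmonicADS.hyperbolicSlice n √(1 - s ^ 2) s) (BiharmonicADS.antiDeSitter n) ∧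
      (∀ R : BiharmonicADS.LocalRep n (n + 1)
          (BiharmonicADS.hyperbolicSlice n √(1 - s ^ 2) s) (BiharmonicADS.antiDeSitter n),
        ∀ x ∈ R.U,
          (∃ η, R.IsUnitNormal x η ∧ ∀ i j, R.B x i j = (s / √(1 - s ^ 2) * R.g x i j) • η) ∧
          R.normSqB x = n * (s ^ 2 / (s ^ 2 - 1))) ∧
      BiharmonicADS.HasConstantMeanCurvature n (n + 1)
        (BiharmonicADS.hyperbolicSlice n √(1 - s ^ 2) s) (BiharmonicADS.antiDeSitter n) ∧
      (BiharmonicADS.IsProperBiharmonic n (n + 1)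
        (BiharmonicADS.hyperbolicSlice n √(1 - s ^ 2) s) (BiharmonicADS.antiDeSitter n) ↔
          s ^ 2 = 1 / 2)) ∧
    -- the product `H^m(1/√2) × H^n(1/√2)` in `H^{m+n+1}_1(1)`
    (∀ m n : ℕ, m ≠ n →
      BiharmonicADS.IsSpacelikeHypersurface (m + n)
        (BiharmonicADS.cliffordTorus m n (1 / √2) (1 / √2))
        (BiharmonicADS.antiDeSitter (m + n)) ∧
      BiharmonicADS.IsProperBiharmonic (m + n) (m + n + 1)
        (BiharmonicADS.cliffordTorus m n (1 / √2) (1 / √2))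
        (BiharmonicADS.antiDeSitter (m + n))) ∧
    -- the products `H^m(r) × H^n(s)`
    (∀ m n : ℕ, ∀ r s : ℝ, 0 < r → 0 < s → r ^ 2 + s ^ 2 = 1 →
      BiharmonicADS.IsSpacelikeHypersurface (m + n)
        (BiharmonicADS.cliffordTorus m n r s) (BiharmonicADS.antiDeSitter (m + n)) ∧
      (∀ R : BiharmonicADS.LocalRep (m + n) (m + n + 1)
          (BiharmonicADS.cliffordTorus m n r s) (BiharmonicADS.antiDeSitter (m + n)),
        ∀ x ∈ R.U,
          (∃ η, R.IsUnitNormal x η ∧ ∀ i j, R.B x i j =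
            (s / r * BiharmonicADS.pip
                (BiharmonicADS.fstPart (m := m) (n := n) (BiharmonicADS.pd i R.X x))
                (BiharmonicADS.fstPart (m := m) (n := n) (BiharmonicADS.pd j R.X x))
              - r / s * BiharmonicADS.pip
                (BiharmonicADS.sndPart (m := m) (n := n) (BiharmonicADS.pd i R.X x))
                (BiharmonicADS.sndPart (m := m) (n := n) (BiharmonicADS.pd j R.X x))) • η) ∧
          R.normSqB x = -(s ^ 2 / r ^ 2 * m + r ^ 2 / s ^ 2 * n)) ∧
      BiharmonicADS.HasConstantMeanCurvature (m + n) (m + n + 1)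
        (BiharmonicADS.cliffordTorus m n r s) (BiharmonicADS.antiDeSitter (m + n)) ∧
      (BiharmonicADS.IsProperBiharmonic (m + n) (m + n + 1)
        (BiharmonicADS.cliffordTorus m n r s) (BiharmonicADS.antiDeSitter (m + n)) ↔
          m ≠ n ∧ r = s)) := by
  have half : (1 / √2 : ℝ) ^ 2 = 1 / 2 := by norm_num
  have half_add : (1 / √2 : ℝ) ^ 2 + (1 / √2) ^ 2 = 1 := by norm_num
  have half_pos : (0 : ℝ) < 1 / √2 := by positivity
  have hN : ∀ n, ∀ p ∈ BiharmonicADS.antiDeSitter n, BiharmonicADS.pip p p = -1 :=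
    fun n p => BiharmonicADS.mem_antiDeSitter.1
  refine ⟨fun n hn => ?_, fun n hn s hs => ?_, fun m n hmn => ?_, fun m n r s hr hs hrs => ?_⟩
  · exact ⟨(BiharmonicADS.hasDiagonalNormal_hyperbolicSlice half_pos half_add)
        |>.isSpacelikeHypersurface (BiharmonicADS.isAdSGraph_hyperbolicSlice half_pos half_add),
      (BiharmonicADS.isProperBiharmonic_hyperbolicSlice_iff hn half_pos half_add).2 half⟩
  · have hs2 : 0 < 1 - s ^ 2 := sub_pos.2 ((sq_lt_one_iff_abs_lt_one s).2 hs)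
    have hr := Real.sqrt_pos.2 hs2
    have hr2 := Real.sq_sqrt hs2.le
    have hrs : √(1 - s ^ 2) ^ 2 + s ^ 2 = 1 := by rw [hr2]; ring
    have D := BiharmonicADS.hasDiagonalNormal_hyperbolicSlice (n := n) hr hrs
    refine ⟨BiharmonicADS.hyperbolicSlice_eq hs,
      D.isSpacelikeHypersurface (BiharmonicADS.isAdSGraph_hyperbolicSlice hr hrs),
      fun R x hx => ⟨?_, ?_⟩, D.hasConstantMeanCurvature (hN n),
      BiharmonicADS.isProperBiharmonic_hyperbolicSlice_iff hn hr hrs⟩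
    · obtain ⟨η, hη, hB⟩ := D.exists_isUnitNormal (hN n) hx
      refine ⟨η, hη, fun i j => ?_⟩
      rw [hB, BiharmonicADS.pip_mul_pd_hyperbolicSlice hr hrs R.paramM hx]
      rfl
    · rw [D.normSqB_eq (hN n) hx, div_pow, hr2, ← neg_sub 1 (s ^ 2), div_neg, mul_neg]
  · exact ⟨(BiharmonicADS.hasDiagonalNormal_cliffordTorus half_pos half_pos half_add)
        |>.isSpacelikeHypersurface
          (BiharmonicADS.isAdSGraph_cliffordTorus half_pos half_pos half_add),
      (BiharmonicADS.isProperBiharmonic_cliffordTorus_iff half_pos half_pos half_add).2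
        ⟨hmn, rfl⟩⟩
  · have D := BiharmonicADS.hasDiagonalNormal_cliffordTorus (m := m) (n := n) hr hs hrs
    refine ⟨D.isSpacelikeHypersurface (BiharmonicADS.isAdSGraph_cliffordTorus hr hs hrs),
      fun R x hx => ⟨?_, D.normSqB_eq (hN _) hx⟩, D.hasConstantMeanCurvature (hN _),
      BiharmonicADS.isProperBiharmonic_cliffordTorus_iff hr hs hrs⟩
    obtain ⟨η, hη, hB⟩ := D.exists_isUnitNormal (hN _) hx
    refine ⟨η, hη, fun i j => ?_⟩
    rw [hB, BiharmonicADS.pip_mul_cliffordTorus, neg_mul, ← sub_eq_add_neg]
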